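/- Let $p$ be an odd prime, $n\ge 2$, $V=\mathbb F_p^n$, and let $$H^*(V)=E_{\mathbb F_p}(x_1,\dots,x_n)\otimes\mathbb F_p[y_1,\dots,y_n],\qquad |x_i|=1,\ |y_i|=2,\ \beta x_i=y_i,$$ be its mod $p$ cohomology, on which $g=(g_{ij})\in GL(n,\mathbb F_p)$ acts by algebra automorphisms with $g x_k=\sum_i g_{ik}x_i$ and $g y_k=\sum_i g_{ik}y_i$. Let $I=(1,n-1)$, let $P(I)\le GL(n,\mathbb F_p)$ be the parabolic subgroup of all invertible block matrices $\begin{pmatrix}A&C\\0&B\end{pmatrix}$ with $A$ of size $1\times1$ and $B$ of size $(n-1)\times(n-1)$, and let $\mathbb F_p(I)=\mathbb F_p[y_1,\dots,y_n]^{P(I)}$. Put $h_j=\prod_{v\in\langle y_1,\dots,y_{j-1}\rangle}(y_j-v)$ for $1\le j\le n$ (so $h_1=y_1$), $L_n=h_1h_2\cdots h_n$, and for $1\le i\le n-1$ $$d_{n,n-i}(I)=\sum_{2\le j_1<\dots<j_i\le n}\ \prod_{s=1}^{i}\bigl(h_{j_s}^{p-1}\bigr)^{p^{\,n-i+s-j_s}}$$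 (the Dickson invariant $d_{n,n-i}$ is the same sum over $1\le j_1<\dots<j_i\le n$). For $m\le n$ and $0\le s_1<\dots<s_k\le m-1$, $k\ge 1$, let $$M_{m,s_1,\dots,s_k}=\frac1{k!}\det\bigl(x,\dots,x,\,y,\dots,\widehat{y^{p^{s_1}}},\dots,\widehat{y^{p^{s_k}}},\dots,y^{p^{m-1}}\bigr)\in H^*(V),$$ where the first $k$ columns are $x=(x_1,\dots,x_m)^t$, the others are the columns $y^{p^t}=(y_1^{p^t},\dots,y_m^{p^t})^t$ for $0\le t\le m-1$, $t\notin\{s_1,\dots,s_k\}$, in increasing order of $t$, and the determinant is expanded with factors in column order (the expression is formed, and divided by $k!$, over $\mathbb Z$ and then reduced mod $p$); in particular $M_{1,0}=x_1$. Then: (1) $\mathbb F_p(I)$ is the polynomial algebra $$\mathbb F_p(I)=\mathbb F_p\bigl[h_1^{p-1},\,d_{n,i}(I)\ :\ 1\le i\le n-1\bigr],$$ that is, these $n$ elements are algebraically independent and generate $\mathbb F_p(I)$. (2) The generating set in (1) is closed under the Steenrod operations: the Bockstein and the reduced powers $P^m$, $m\ge0$, carry polynomials in these generators to polynomials in these generators.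 (3) As a module over $\mathbb F_p(I)$, $$H^*(V)^{P(I)}=\mathbb F_p(I)\ \oplus\ \mathbb F_p(I)\,M_{1,0}h_1^{p-2}\ \oplus\bigoplus_{\substack{0\le t_1<\dots<t_k\le n-1\\ k\ge1,\ t_k\ge1}}\mathbb F_p(I)\,M_{n,t_1,\dots,t_k}L_n^{p-2},$$ that is, $H^*(V)^{P(I)}$ is the free $\mathbb F_p(I)$-module on the elements $1$, $M_{1,0}h_1^{p-2}$ and $M_{n,t_1,\dots,t_k}L_n^{p-2}$ with $t_k\ge 1$. -/

import Mathlib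

open scoped TensorProduct

noncomputable section

namespace ParabolicInvariants

/-- The polynomial part `F_p[y_1, …, y_n]`; the variable `y_{i+1}` is `X i`, `i : Fin n`. -/
abbrev PolyPart (p n : ℕ) : Type := MvPolynomial (Fin n) (ZMod p)

/-- The exterior part `E(x_1, …, x_n)` over `F_p`. -/
abbrev ExtPart (p n : ℕ) : Type := ExteriorAlgebra (ZMod p) (Fin n → ZMod p)

/-- `H^*(V) = E(x_1, …, x_n) ⊗ F_p[y_1, …, y_n]` for `p` odd, `V = F_p^n`. As `F_p[y]` lies in even
degrees, the graded tensor product is the ordinary one and its factors may be written in either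
order; the polynomial factor is put first so that `H^*(V)` is an algebra over it. -/
abbrev Coh (p n : ℕ) : Type := PolyPart p n ⊗[ZMod p] ExtPart p n

/-- The class `x_{i+1}` of degree one. -/
def xCl (p n : ℕ) (i : Fin n) : Coh p n :=
  (1 : PolyPart p n) ⊗ₜ[ZMod p] ExteriorAlgebra.ι (ZMod p) (Pi.single i (1 : ZMod p))

/-- The class `y_{i+1}` of degree two. -/
def yCl (p n : ℕ) (i : Fin n) : Coh p n :=
  (MvPolynomial.X i : PolyPart p n) ⊗ₜ[ZMod p] (1 : ExtPart p n)

/-! ### The action of the general linear group -/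

/-- The action on `F_p[y]`: `g y_k = ∑ i, g_{i k} y_i`. -/
def actPoly (p n : ℕ) (g : GL (Fin n) (ZMod p)) : PolyPart p n →ₐ[ZMod p] PolyPart p n :=
  MvPolynomial.aeval fun k => ∑ i, MvPolynomial.C (g.val i k) * MvPolynomial.X i

/-- The action on `E(x)`: `g x_k = ∑ i, g_{i k} x_i`. -/
def actExt (p n : ℕ) (g : GL (Fin n) (ZMod p)) : ExtPart p n →ₐ[ZMod p] ExtPart p n :=
  ExteriorAlgebra.map (Matrix.mulVecLin g.val)

/-- The diagonal action on `H^*(V)`. -/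
def actCoh (p n : ℕ) (g : GL (Fin n) (ZMod p)) : Coh p n →ₐ[ZMod p] Coh p n :=
  Algebra.TensorProduct.map (actPoly p n g) (actExt p n g)

/-- The parabolic subgroup `P(k, n - k)` of all invertible matrices `(A, C; 0, B)` with `A` of size
`k × k` and `B` of size `(n - k) × (n - k)`. -/
def parabolic (p n k : ℕ) [Fact p.Prime] : Subgroup (GL (Fin n) (ZMod p)) where
  carrier := {g | Matrix.BlockTriangular g.val fun i : Fin n => decide (k ≤ (i : ℕ))}
  mul_mem' := fun ha hb => Matrix.BlockTriangular.mul ha hb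
  one_mem' := Matrix.blockTriangular_one
  inv_mem' := by
    intro g hg
    have h := Matrix.blockTriangular_inv_of_blockTriangular (M := g.val) hg
    simpa [Matrix.coe_units_inv] using h

theorem mem_parabolic (p n k : ℕ) [Fact p.Prime] (g : GL (Fin n) (ZMod p)) :
    g ∈ parabolic p n k ↔ ∀ i j : Fin n, k ≤ (i : ℕ) → (j : ℕ) < k → g.val i j = 0 := by
  change (∀ i j : Fin n, decide (k ≤ (j : ℕ)) < decide (k ≤ (i : ℕ)) → g.val i j = 0) ↔ _
  refine forall_congr' fun i => forall_congr' fun j => ?_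
  simp only [Bool.lt_iff, decide_eq_false_iff_not, decide_eq_true_eq, not_le]
  tauto

/-- The ring of invariants `F_p[y_1, …, y_n]^G`. -/
def polyInvariants (p n : ℕ) (G : Subgroup (GL (Fin n) (ZMod p))) :
    Subalgebra (ZMod p) (PolyPart p n) :=
  ⨅ g ∈ G, AlgHom.equalizer (actPoly p n g) (AlgHom.id (ZMod p) (PolyPart p n))

theorem mem_polyInvariants (p n : ℕ) (G : Subgroup (GL (Fin n) (ZMod p))) (f : PolyPart p n) :
    f ∈ polyInvariants p n G ↔ ∀ g ∈ G, actPoly p n g f = f := by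
  simp [polyInvariants, Algebra.mem_iInf, AlgHom.mem_equalizer]

/-- The ring of invariants `H^*(V)^G`. -/
def cohInvariants (p n : ℕ) (G : Subgroup (GL (Fin n) (ZMod p))) :
    Subalgebra (ZMod p) (Coh p n) :=
  ⨅ g ∈ G, AlgHom.equalizer (actCoh p n g) (AlgHom.id (ZMod p) (Coh p n))

theorem mem_cohInvariants (p n : ℕ) (G : Subgroup (GL (Fin n) (ZMod p))) (z : Coh p n) :
    z ∈ cohInvariants p n G ↔ ∀ g ∈ G, actCoh p n g z = z := by
  simp [cohInvariants, Algebra.mem_iInf, AlgHom.mem_equalizer]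

/-! ### The polynomial generators -/

/-- `hPoly p n j` is `h_{j+1} = ∏ (y_{j+1} - v)`, where `v` runs over the span of
`y_1, …, y_j`; its elements are the combinations `∑ k, c_k y_{k+1}` with `c_k = 0` for `k ≥ j`. -/
def hPoly (p n : ℕ) [Fact p.Prime] (j : Fin n) : PolyPart p n :=
  ∏ c : Fin n → ZMod p with ∀ k, j ≤ k → c k = 0,
    (MvPolynomial.X j - ∑ k, MvPolynomial.C (c k) * MvPolynomial.X k)

/-- `L_n = h_1 ⋯ h_n`. -/
def lPoly (p n : ℕ) [Fact p.Prime] : PolyPart p n := ∏ j, hPoly p n j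

/-- The polynomial
`F_{n,r}(z_1, …, z_n) = ∑_{j_1 < ⋯ < j_r} ∏_s z_{j_s} ^ (p ^ (n - r + s - j_s))`, for which
`F_{n,r}(h_1^{p-1}, …, h_n^{p-1})` is the Dickson invariant `d_{n,n-r}`. For `j = j_s` in the set `A`
the number of elements of `A` below `j` is `s - 1`, and `j` stands for the index `j_s - 1`, so that
the exponent is the displayed one; it is never negative as `n - j_s ≥ r - s`. -/
def dicksonForm (p n r : ℕ) : MvPolynomial (Fin n) (ZMod p) :=
  ∑ A ∈ (Finset.univ : Finset (Fin n)).powersetCard r,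
    ∏ j ∈ A, MvPolynomial.X j ^ (p ^ (n - r + (A.filter (· < j)).card - (j : ℕ)))

/-- `d_{n,i}(I) = F_{n,n-i}(0, …, 0, h_{k+1}^{p-1}, …, h_n^{p-1})` for `I = (k, n - k)`. -/
def dParabolic (p n k : ℕ) [Fact p.Prime] (i : ℕ) : PolyPart p n :=
  MvPolynomial.aeval (fun j : Fin n => if (j : ℕ) < k then 0 else hPoly p n j ^ (p - 1))
    (dicksonForm p n (n - i))

/-- The family `h_1^{p-1}, d_{n,1}(I), …, d_{n,n-1}(I)` for `I = (1, n - 1)`. -/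
def polyGen (p n : ℕ) [Fact p.Prime] (i : Fin n) : PolyPart p n :=
  if (i : ℕ) = 0 then hPoly p n i ^ (p - 1) else dParabolic p n 1 i

/-! ### The exterior generators -/

/-- For `S = {s_1 < ⋯ < s_k}`, with `s_i < m`, and anticommuting `x_i`, `(1 / k!)` times the
determinant with the `m` columns `x` (`k` times) and then `y^{p^t}`, for `0 ≤ t ≤ m - 1`, `t ∉ S`,
in increasing order. In the expansion `∑_σ sign σ ∏_c a_{σ c, c}` of the determinant (the product
over the columns `c` is taken from left to right) permuting the `k` entries taken from the columns
`x` does not change a term, so that `1 / k!` times it is the sum over those `σ` that increase on the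
first `k` columns. -/
def muiDet {A : Type*} [Ring A] (p : ℕ) {m : ℕ} (x y : Fin m → A) (S : Finset ℕ) : A :=
  ∑ σ : Equiv.Perm (Fin m) with ∀ a b : Fin m, a < b → (b : ℕ) < S.card → σ a < σ b,
    ((Equiv.Perm.sign σ : ℤˣ) : ℤ) •
      (List.ofFn fun c : Fin m =>
        if (c : ℕ) < S.card then x (σ c)
        else y (σ c) ^ (p ^ Nat.nth (fun t => t ∉ S) ((c : ℕ) - S.card))).prod

/-- `M_{m, s_1, …, s_k}` in `H^*(V)`, for `S = {s_1 < ⋯ < s_k}` and `m ≤ n`: the above with the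
classes `x_1, …, x_m` and `y_1, …, y_m`. -/
def muiM (p n m : ℕ) (hm : m ≤ n) (S : Finset ℕ) : Coh p n :=
  muiDet p (fun i : Fin m => xCl p n (i.castLE hm)) (fun i : Fin m => yCl p n (i.castLE hm)) S

/-- The index sets `{t_1 < ⋯ < t_k}` with `0 ≤ t_1`, `t_k ≤ n - 1` and `1 ≤ t_k`. -/
abbrev TopIndex (n : ℕ) : Type := {T : Finset ℕ // (∀ t ∈ T, t < n) ∧ ∃ t ∈ T, 1 ≤ t}

/-- The module generators of `H^*(V)^{P(1, n-1)}`: `1`, `M_{1,0} h_1^{p-2}` and the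
`M_{n, t_1, …, t_k} L_n^{p-2}` with `1 ≤ t_k`. -/
def cohGen (p n : ℕ) [Fact p.Prime] (hn : 2 ≤ n) : Unit ⊕ Unit ⊕ TopIndex n → Coh p n
  | .inl _ => 1
  | .inr (.inl _) =>
      muiM p n 1 (by omega) {0} * ((hPoly p n ⟨0, by omega⟩ ^ (p - 2)) ⊗ₜ[ZMod p] 1)
  | .inr (.inr T) => muiM p n n le_rfl T.val * ((lPoly p n ^ (p - 2)) ⊗ₜ[ZMod p] 1)

/-! ### The Steenrod operations -/

/-- The total reduced power on `F_p[y]`: the ring map `y_i ↦ y_i + y_i^p T`. -/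
def totalPower (p n : ℕ) : PolyPart p n →ₐ[ZMod p] Polynomial (PolyPart p n) :=
  MvPolynomial.aeval fun i =>
    Polynomial.C (MvPolynomial.X i) + Polynomial.C (MvPolynomial.X i ^ p) * Polynomial.X

/-- The reduced power `P^m` on `F_p[y]`, the coefficient of `T^m` in the total one. -/
def powerPoly (p n m : ℕ) : PolyPart p n →ₗ[ZMod p] PolyPart p n :=
  (Polynomial.lcoeff (PolyPart p n) m).restrictScalars (ZMod p) ∘ₗ (totalPower p n).toLinearMap

/-- The reduced power `P^m` on `H^*(V)`. The total power is multiplicative and fixes each `x_i`. -/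
def powerCoh (p n m : ℕ) : Coh p n →ₗ[ZMod p] Coh p n :=
  TensorProduct.map (powerPoly p n m) LinearMap.id

/-- The Bockstein on `H^*(V)`: the graded derivation with `β x_i = y_i` and `β y_i = 0`. -/
def bockstein (p n : ℕ) : Coh p n →ₗ[ZMod p] Coh p n :=
  ∑ i : Fin n, TensorProduct.map (LinearMap.mulLeft (ZMod p) (MvPolynomial.X i : PolyPart p n))
    (CliffordAlgebra.contractLeft (Q := (0 : QuadraticForm (ZMod p) (Fin n → ZMod p)))
      (LinearMap.proj i : (Fin n → ZMod p) →ₗ[ZMod p] ZMod p))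

/-- A subalgebra of `H^*(V)` is closed under the Steenrod algebra, which is generated by the
Bockstein and the reduced powers. -/
def SteenrodClosed (p n : ℕ) (B : Subalgebra (ZMod p) (Coh p n)) : Prop :=
  (∀ z ∈ B, bockstein p n z ∈ B) ∧ ∀ m : ℕ, ∀ z ∈ B, powerCoh p n m z ∈ B

end ParabolicInvariants

end

/-! Write P for the parabolic subgroup and B for the algebra generated by the proposed polynomial
generators. Polynomial invariants. Let V_j be the monic polynomial whose roots are the
F_p-combinations of y_1, …, y_j. It satisfies V_{j+1} = V_j^p - h_{j+1}^{p-1} V_j, so V_n = W(X^p -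
h_1^{p-1} X), where W comes from the same recursion run on h_2^{p-1}, …, h_n^{p-1}. Replacing
h_1^{p-1} by 0 turns V_n into W(X^p), so the coefficients of W below the leading one are, up to
sign, the d_{n,i}(I). Since P permutes the roots of V_n and fixes h_1^{p-1}, it fixes W: hence B
consists of invariants. Conversely y_1 is a root of X^{p-1} - h_1^{p-1}, and y_{j+1} is a root of
V_n / V_j, of degree p^n - p^j, for j ≥ 1. So F_p[y] is spanned over B by (p-1) ∏_{1 ≤ j < n} (p^n -
p^j) elements. This number is at most |P|, and independence of characters (`SpannedBy.mem_of_fixed`)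
puts every invariant in B. Finiteness of F_p[y] over B and transcendence degree n give algebraic
independence. Steenrod operations. The total power y ↦ y + y^p T commutes with the linear group, so
the reduced powers preserve invariants; the Bockstein vanishes on polynomials. Module structure. The
substitution x_i ↦ ∑_t y_i^{p^t} x_t is injective, because its determinant is L_n, and it carries
the diagonal action to the action on coefficients alone (`substX_frobMatrix_actCoh`). Thus a class
is invariant exactly when all its twisted coordinates `frobCoord` are invariant polynomials. A
Laplace expansion shows that M_{n,T} becomes ± L_n x_T, so M_{n,T} L_n^{p-2} has the single
coordinate ± L_n^{p-1}, at T. What remains is divisibility. Transvections and diagonal matrices in P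
force powers of y_b into the coordinates of an invariant f. The coordinate at the first singleton is
divisible by y_1^{p-1}, so a multiple of M_{1,0} h_1^{p-2} can be subtracted to kill it. Afterwards
every coordinate at a nonempty set is divisible by all y_b^{p-1}, hence by L_n^{p-1} because P moves
each y_b with b > 1 to every linear form involving it. Dividing yields the expansion of f, and
reading coordinates in a triangular order yields independence. -/

noncomputable section

namespace ParabolicInvariants

/-! ### A Laplace expansion along the first columns -/

section Laplace

open Equiv Finset

/-- A permutation of the first `k` indices, extended by the identity. -/
def extendPerm {k : ℕ} (m : ℕ) (π : Perm (Fin k)) : Perm (Fin (k + m)) :=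
  finSumFinEquiv.permCongr (Perm.sumCongr π 1)

@[simp] theorem extendPerm_castAdd {k m : ℕ} (π : Perm (Fin k)) (i : Fin k) :
    extendPerm m π (Fin.castAdd m i) = Fin.castAdd m (π i) := by
  simp [extendPerm, Equiv.permCongr_apply]

@[simp] theorem extendPerm_natAdd {k m : ℕ} (π : Perm (Fin k)) (i : Fin m) :
    extendPerm m π (Fin.natAdd k i) = Fin.natAdd k i := by
  simp [extendPerm, Equiv.permCongr_apply]

theorem sign_extendPerm {k m : ℕ} (π : Perm (Fin k)) :
    Perm.sign (extendPerm m π) = Perm.sign π := by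
  simp [extendPerm, Perm.sign_permCongr, Perm.sign_sumCongr]

theorem extendPerm_inv_mul {k m : ℕ} (π : Perm (Fin k)) :
    extendPerm m π * extendPerm m π⁻¹ = 1 := by
  refine Equiv.ext fun i => ?_
  refine Fin.addCases (fun i => ?_) (fun i => ?_) i
  · have h : π (π⁻¹ i) = i := by simp
    rw [Perm.mul_apply, extendPerm_castAdd, extendPerm_castAdd, h, Perm.one_apply]
  · rw [Perm.mul_apply, extendPerm_natAdd, extendPerm_natAdd, Perm.one_apply]

/-- The permutations increasing on the first `k` indices. -/
def IsShuffle (k : ℕ) {n : ℕ} (σ : Perm (Fin n)) : Prop :=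
  ∀ a b : Fin n, a < b → (b : ℕ) < k → σ a < σ b

instance (k n : ℕ) : DecidablePred (IsShuffle k (n := n)) := fun σ => by
  unfold IsShuffle; exact inferInstance

theorem IsShuffle.strictMono {k m : ℕ} {σ : Perm (Fin (k + m))} (h : IsShuffle k σ) :
    StrictMono fun i => σ (Fin.castAdd m i) := fun _ b hab =>
  h _ _ hab b.2

/-- Every permutation factors uniquely as a shuffle followed on the source side by a permutation of
the first k indices. Grouping the Leibniz expansion by the shuffle collects the k × k minors. A
shuffle here is unrestricted on the last m indices. -/
theorem sum_shuffle_det {S : Type*} [CommRing S] (k m : ℕ)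
    (N : Matrix (Fin (k + m)) (Fin (k + m)) S) :
    ∑ σ : Perm (Fin (k + m)) with IsShuffle k σ, ((Perm.sign σ : ℤˣ) : ℤ) •
      ((∏ j : Fin m, N (σ (Fin.natAdd k j)) (Fin.natAdd k j)) *
        (Matrix.of fun i j : Fin k => N (σ (Fin.castAdd m i)) (Fin.castAdd m j)).det) = N.det := by
  rw [Matrix.det_apply N]
  simp_rw [Matrix.det_apply, Finset.mul_sum, Finset.smul_sum]
  rw [← Finset.sum_product']
  refine Finset.sum_bij (fun x _ => x.1 * extendPerm m x.2) (fun _ _ => mem_univ _) ?_ ?_ ?_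
  · rintro ⟨σ, π⟩ h ⟨σ', π'⟩ h' heq
    simp only [mem_product, mem_filter, mem_univ, true_and, and_true] at h h'
    have e : ∀ i, σ (Fin.castAdd m (π i)) = σ' (Fin.castAdd m (π' i)) := fun i => by
      simpa only [Perm.mul_apply, extendPerm_castAdd] using
        congrArg (fun τ : Perm (Fin (k + m)) => τ (Fin.castAdd m i)) heq
    -- The two shuffles take the same set of values on the first k indices, and each lists it in
    -- increasing order.
    have hr : (fun i => σ (Fin.castAdd m i)) = fun i => σ' (Fin.castAdd m i) := by
      refine (StrictMono.range_inj h.strictMono h'.strictMono).1 (Set.ext fun y => ⟨?_, ?_⟩)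
      · rintro ⟨i, rfl⟩
        exact ⟨π' (π⁻¹ i), by simp [← e]⟩
      · rintro ⟨i, rfl⟩
        exact ⟨π (π'⁻¹ i), by simp [e]⟩
    have hπ : π = π' := by
      ext i
      have h1 := e i
      rw [← congrFun hr (π' i)] at h1
      have := σ.injective h1
      simpa using congrArg Fin.val this
    subst hπ
    have : σ = σ' := mul_right_cancel heq
    rw [this]
  · intro τ _
    -- Sorting the first k values of τ produces the shuffle; the inverse of the sorting permutation
    -- recovers τ.
    refine ⟨(τ * extendPerm m (Tuple.sort fun i => τ (Fin.castAdd m i)),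
      (Tuple.sort fun i => τ (Fin.castAdd m i))⁻¹), ?_, ?_⟩
    · simp only [mem_product, mem_filter, mem_univ, true_and, and_true]
      intro a b hab hb
      have hm := Tuple.monotone_sort fun i => τ (Fin.castAdd m i)
      have hs : StrictMono ((fun i => τ (Fin.castAdd m i)) ∘
          Tuple.sort fun i => τ (Fin.castAdd m i)) :=
        hm.strictMono_of_injective (((τ.injective.comp (Fin.castAdd_injective k m))).comp
          (Equiv.injective _))
      have := @hs ⟨a, lt_trans hab hb⟩ ⟨b, hb⟩ hab
      have h (i : Fin k) : (τ * extendPerm m (Tuple.sort fun i => τ (Fin.castAdd m i)))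
          (Fin.castAdd m i) = ((fun i => τ (Fin.castAdd m i)) ∘
            Tuple.sort fun i => τ (Fin.castAdd m i)) i := by
        rw [Perm.mul_apply, extendPerm_castAdd, Function.comp_apply]
      rw [← h, ← h] at this
      exact this
    · simp [mul_assoc, extendPerm_inv_mul]
  · rintro ⟨σ, π⟩ _
    simp only [Perm.sign_mul, sign_extendPerm, Units.smul_def, Units.val_mul, Fin.prod_univ_add,
      Perm.mul_apply, extendPerm_castAdd, extendPerm_natAdd, Matrix.of_apply, zsmul_eq_mul]
    push_cast
    ring

open exteriorPower in
-- The coordinate of the left side at a k-set U is the determinant of M with its first k columns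
-- replaced by those indexed by U. It is det M times a determinant of standard vectors, which is the
-- corresponding coordinate of the right side.
theorem sum_shuffle_ιMulti {S : Type*} [CommRing S] (k m : ℕ)
    (M : Matrix (Fin (k + m)) (Fin (k + m)) S) :
    ∑ σ : Perm (Fin (k + m)) with IsShuffle k σ, ((Perm.sign σ : ℤˣ) : ℤ) •
      ((∏ j : Fin m, M (σ (Fin.natAdd k j)) (Fin.natAdd k j)) •
        ιMulti S k fun c => M (σ (Fin.castAdd m c))) =
      M.det • ιMulti S k fun c => Pi.single (Fin.castAdd m c) (1 : S) := by
  refine ((Pi.basisFun S (Fin (k + m))).exteriorPower k).ext_elem fun U => ?_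
  have hc := fun x => basis_repr_apply S k (Pi.basisFun S (Fin (k + m))) x U
  rw [hc, hc, map_sum]
  simp only [map_zsmul, map_smul, ιMultiDual_apply_ιMulti, Module.Basis.coord_apply,
    Pi.basisFun_repr]
  set u := Set.powersetCard.ofFinEmbEquiv.symm U
  let N : Matrix (Fin (k + m)) (Fin (k + m)) S := Matrix.of fun i c =>
    Fin.addCases (fun j => M i (u j)) (fun j => M i (Fin.natAdd k j)) c
  have hN := sum_shuffle_det k m N
  simp only [N, Matrix.of_apply, Fin.addCases_left, Fin.addCases_right] at hN
  simp only [smul_eq_mul]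
  rw [hN]
  have hmul : N = M * Matrix.of fun i c => Fin.addCases (fun j => (Pi.single (u j) 1 : _ → S) i)
      (fun j => (Pi.single (Fin.natAdd k j) 1 : _ → S) i) c := by
    ext i c
    rw [Matrix.mul_apply]
    refine Fin.addCases (fun j => ?_) (fun j => ?_) c <;> simp [N, Pi.single_apply]
  change N.det = _
  rw [hmul, Matrix.det_mul]
  congr 1
  -- The columns are e_{u_j} followed by e_{k+j}: the upper right block is 0 and the lower right
  -- block is 1, so only the upper left minor survives.
  rw [← Matrix.det_submatrix_equiv_self finSumFinEquiv, ← Matrix.fromBlocks_toBlocks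
    (Matrix.submatrix _ finSumFinEquiv finSumFinEquiv)]
  have h12 : Matrix.toBlocks₁₂ (Matrix.submatrix (Matrix.of fun i c =>
      Fin.addCases (fun j => (Pi.single (u j) 1 : _ → S) i)
      (fun j => (Pi.single (Fin.natAdd k j) 1 : _ → S) i) c) finSumFinEquiv finSumFinEquiv) =
      (0 : Matrix (Fin k) (Fin m) S) := by
    ext i j
    simp [Matrix.toBlocks₁₂, Fin.ext_iff, Pi.single_apply]
    omega
  have h22 : Matrix.toBlocks₂₂ (Matrix.submatrix (Matrix.of fun i c =>
      Fin.addCases (fun j => (Pi.single (u j) 1 : _ → S) i)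
      (fun j => (Pi.single (Fin.natAdd k j) 1 : _ → S) i) c) finSumFinEquiv finSumFinEquiv) =
      (1 : Matrix (Fin m) (Fin m) S) := by
    ext i j
    simp [Matrix.toBlocks₂₂, Pi.single_apply, Matrix.one_apply]
  rw [h12, h22, Matrix.det_fromBlocks_zero₁₂, Matrix.det_one, mul_one]
  congr 1
  ext i j
  simp [Matrix.toBlocks₁₁, Pi.single_apply, u, eq_comm]

end Laplace

/-! ### The determinants under a linear substitution of the exterior variables -/

section MuiDet

open Equiv Finset

/-- The indices of `Fin (k + m)` with those in a `k`-element set `J` first. -/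
def columnOrder {k m : ℕ} (J : Finset (Fin (k + m))) (hJ : J.card = k) (i : Fin (k + m)) : ℕ :=
  Fin.addCases (fun i : Fin k => ((J.orderEmbOfFin hJ i : Fin (k + m)) : ℕ))
    (fun j : Fin m => Nat.nth (fun t => t ∉ J.map Fin.valEmbedding) j) i

theorem infinite_notMem (T : Finset ℕ) : (Set.ofPred fun t => t ∉ T).Infinite :=
  T.finite_toSet.infinite_compl

theorem columnOrder_lt {k m : ℕ} (J : Finset (Fin (k + m))) (hJ : J.card = k) (i : Fin (k + m)) :
    columnOrder J hJ i < k + m := by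
  refine Fin.addCases (fun i => ?_) (fun j => ?_) i
  · simp [columnOrder]
  · simp only [columnOrder, Fin.addCases_right]
    refine Nat.nth_lt_of_lt_count ?_
    rw [Nat.count_eq_card_filter_range]
    have h : (range (k + m)).filter (fun t => t ∉ J.map Fin.valEmbedding) =
        range (k + m) \ J.map Fin.valEmbedding := by
      ext t; simp
    rw [h, card_sdiff_of_subset, card_map, hJ, card_range]
    · omega
    · intro t ht
      obtain ⟨i, -, rfl⟩ := mem_map.1 ht
      simp

theorem columnOrder_injective {k m : ℕ} (J : Finset (Fin (k + m))) (hJ : J.card = k) :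
    Function.Injective (columnOrder J hJ) := by
  have hmem : ∀ i : Fin k, columnOrder J hJ (Fin.castAdd m i) ∈ J.map Fin.valEmbedding := by
    intro i
    simp only [columnOrder, Fin.addCases_left]
    exact mem_map_of_mem _ (J.orderEmbOfFin_mem hJ i)
  have hnot : ∀ i : Fin m, columnOrder J hJ (Fin.natAdd k i) ∉ J.map Fin.valEmbedding := by
    intro i
    simp only [columnOrder, Fin.addCases_right]
    exact Nat.nth_mem_of_infinite (infinite_notMem _) _
  intro i j
  refine Fin.addCases (fun i => ?_) (fun i => ?_) i <;>
    refine Fin.addCases (fun j => ?_) (fun j => ?_) j <;> intro h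
  · simp only [columnOrder, Fin.addCases_left] at h
    exact congrArg _ ((J.orderEmbOfFin hJ).injective (Fin.ext h))
  · exact absurd (h ▸ hmem i) (hnot j)
  · exact absurd (h ▸ hmem j) (hnot i)
  · simp only [columnOrder, Fin.addCases_right] at h
    exact congrArg _ (Fin.ext (Nat.nth_injective (infinite_notMem _) h))

/-- `columnOrder` as a permutation. -/
def columnPerm {k m : ℕ} (J : Finset (Fin (k + m))) (hJ : J.card = k) : Perm (Fin (k + m)) :=
  Equiv.ofBijective (fun i => ⟨columnOrder J hJ i, columnOrder_lt J hJ i⟩)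
    (Finite.injective_iff_bijective.1 fun _ _ h =>
      columnOrder_injective J hJ (congrArg Fin.val h))

theorem columnPerm_castAdd {k m : ℕ} (J : Finset (Fin (k + m))) (hJ : J.card = k) (i : Fin k) :
    columnPerm J hJ (Fin.castAdd m i) = J.orderEmbOfFin hJ i := by
  ext
  simp [columnPerm, columnOrder]

theorem columnPerm_natAdd {k m : ℕ} (J : Finset (Fin (k + m))) (hJ : J.card = k) (i : Fin m) :
    (columnPerm J hJ (Fin.natAdd k i) : ℕ) = Nat.nth (fun t => t ∉ J.map Fin.valEmbedding) i := by
  simp [columnPerm, columnOrder]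

variable {S A : Type*} [CommRing S] [Ring A] [Algebra S A]

/-- A linear map with square-zero values extends to the exterior algebra, so the identity in the
exterior power can be pushed into any algebra. -/
theorem sum_shuffle_prod (k m : ℕ) (M : Matrix (Fin (k + m)) (Fin (k + m)) S)
    (ξ : (Fin (k + m) → S) →ₗ[S] A) (hξ : ∀ v, ξ v * ξ v = 0) :
    ∑ σ : Perm (Fin (k + m)) with IsShuffle k σ, ((Perm.sign σ : ℤˣ) : ℤ) •
      ((∏ j : Fin m, M (σ (Fin.natAdd k j)) (Fin.natAdd k j)) •
        (List.ofFn fun c : Fin k => ξ (M (σ (Fin.castAdd m c)))).prod) =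
      M.det • (List.ofFn fun c : Fin k => ξ (Pi.single (Fin.castAdd m c) (1 : S))).prod := by
  have h := congrArg ((ExteriorAlgebra.lift S ⟨ξ, hξ⟩).toLinearMap ∘ₗ
    Submodule.subtype (⋀[S]^k (Fin (k + m) → S))) (sum_shuffle_ιMulti k m M)
  simpa [map_sum, map_zsmul, ExteriorAlgebra.ιMulti_apply, map_list_prod, List.map_ofFn,
    Function.comp_def] using h

/-- If x_i is the i-th row of Y paired with new odd variables, the columns y^{p^t} with t ∉ J cancel
all contributions outside J. What is left is det Y times the monomial on J, with the sign of the
permutation moving the columns of J to the front. -/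
theorem muiDet_eq {n : ℕ} (p : ℕ) (J : Finset (Fin n)) (ξ : (Fin n → S) →ₗ[S] A)
    (hξ : ∀ v, ξ v * ξ v = 0) (Y : Matrix (Fin n) (Fin n) S) (y : Fin n → A)
    (hy : ∀ i t : Fin n, y i ^ p ^ (t : ℕ) = algebraMap S A (Y i t)) :
    ∃ ε : ℤˣ, muiDet p (fun i => ξ (Y i)) y (J.map Fin.valEmbedding) =
      (ε : ℤ) • Y.det •
        (List.ofFn fun c : Fin J.card => ξ (Pi.single (J.orderEmbOfFin rfl c) 1)).prod := by
  obtain ⟨m, hm⟩ := Nat.exists_eq_add_of_le (J.card_le_univ.trans_eq (Fintype.card_fin n))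
  obtain ⟨k, hk⟩ : ∃ k, J.card = k := ⟨_, rfl⟩
  have hr : (List.ofFn fun c : Fin J.card => ξ (Pi.single (J.orderEmbOfFin rfl c) 1)) =
      List.ofFn fun c : Fin k => ξ (Pi.single (J.orderEmbOfFin hk c) 1) := by
    subst hk
    rfl
  rw [hr]
  clear hr
  rw [hk] at hm
  subst hm
  set ρ := columnPerm J hk with hρ
  refine ⟨Perm.sign ρ, ?_⟩
  -- Permuting the columns of Y by ρ is undone by relabelling the odd variables by ρ⁻¹, so each row
  -- still gives the same element.
  have h := sum_shuffle_prod k m (Y.submatrix id ρ) (ξ ∘ₗ (LinearMap.funLeft S S ρ.symm))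
    (fun v => hξ _)
  have h1 : ∀ i : Fin (k + m), (LinearMap.funLeft S S ρ.symm) (Y.submatrix id ρ i) = Y i := by
    intro i; ext t; simp [LinearMap.funLeft_apply]
  have h2 : ∀ i : Fin (k + m), (LinearMap.funLeft S S ρ.symm) (Pi.single i 1) =
      Pi.single (ρ i) 1 := by
    intro i; ext t; simp [LinearMap.funLeft_apply, Pi.single_apply, Equiv.symm_apply_eq]
  simp only [LinearMap.comp_apply, h1, h2, Matrix.det_permute'] at h
  rw [← smul_assoc, zsmul_eq_mul]
  simp only [hρ, columnPerm_castAdd] at h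
  rw [← hρ] at h
  rw [← h, muiDet, card_map, hk]
  refine Finset.sum_congr rfl fun σ _ => ?_
  congr 1
  rw [List.ofFn_add, List.prod_append, Algebra.smul_def, Algebra.commutes, ← List.prod_ofFn,
    map_list_prod, List.map_ofFn]
  simp only [Function.comp_def, Matrix.submatrix_apply, id, ← hy]
  simp only [hρ, columnPerm_natAdd]
  simp
  rfl

end MuiDet

/-! ### Additive polynomials and Dickson sums -/

section Moore

open Polynomial Finset

variable {R : Type*} [CommRing R]

/-- The additive polynomials `V_0 = X`, `V_{j+1} = V_j ^ p - a_j V_j`. -/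
def moorePoly (p : ℕ) (a : ℕ → R) : ℕ → R[X]
  | 0 => X
  | j + 1 => moorePoly p a j ^ p - C (a j) * moorePoly p a j

/-- The forms of `dicksonForm` in the first `j` terms of a sequence. -/
def dicksonSum (p : ℕ) (a : ℕ → R) (j r : ℕ) : R :=
  ∑ A ∈ (range j).powersetCard r,
    ∏ i ∈ A, a i ^ p ^ (j - r + (A.filter (· < i)).card - i)

@[simp] theorem dicksonSum_zero (p : ℕ) (a : ℕ → R) (j : ℕ) : dicksonSum p a j 0 = 1 := by
  simp [dicksonSum]

theorem dicksonSum_of_lt (p : ℕ) (a : ℕ → R) {j r : ℕ} (h : j < r) : dicksonSum p a j r = 0 := by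
  rw [dicksonSum, powersetCard_eq_empty.2 (by simpa using h), sum_empty]

theorem sub_le_of_mem_powersetCard {j r i : ℕ} {A : Finset ℕ}
    (hA : A ∈ (range j).powersetCard r) (hi : i ∈ A) :
    i ≤ j - r + (A.filter (· < i)).card := by
  rw [mem_powersetCard] at hA
  have hij : i < j := mem_range.1 (hA.1 hi)
  have h1 : (A.filter (i ≤ ·)).card ≤ j - i := by
    rw [← Nat.card_Ico]
    refine card_le_card fun x hx => ?_
    rw [mem_filter] at hx
    exact mem_Ico.2 ⟨hx.2, mem_range.1 (hA.1 hx.1)⟩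
  have h2 := card_filter_add_card_filter_not (s := A) (· < i)
  simp only [not_lt] at h2
  omega

/-- Split the index sets A by whether j ∈ A. If not, every exponent of p goes up by one, which is a
p-th power of the whole sum in characteristic p. If so, a_j occurs to the first power and the other
exponents are unchanged. -/
theorem dicksonSum_succ_succ (p : ℕ) [Fact p.Prime] [CharP R p] (a : ℕ → R) (j r : ℕ)
    (hr : r ≤ j) :
    dicksonSum p a (j + 1) (r + 1) = dicksonSum p a j (r + 1) ^ p + a j * dicksonSum p a j r := by
  have hj : j ∉ range j := by simp
  rw [dicksonSum, range_add_one, powersetCard_succ_insert hj, sum_union]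
  · congr 1
    · rw [dicksonSum, sum_pow_char]
      refine sum_congr rfl fun A hA => ?_
      rw [← prod_pow]
      refine prod_congr rfl fun i hi => ?_
      rw [← pow_mul, ← pow_succ]
      have := sub_le_of_mem_powersetCard hA hi
      have hA' := (mem_powersetCard.1 hA)
      have := card_le_card hA'.1
      rw [card_range, hA'.2] at this
      congr 2
      omega
    · rw [sum_image, dicksonSum, mul_sum]
      · refine sum_congr rfl fun A hA => ?_
        have hA' := (mem_powersetCard.1 hA)
        have hjA : j ∉ A := fun h => hj (hA'.1 h)
        rw [prod_insert hjA]
        congr 1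
        · have : (insert j A).filter (· < j) = A := by
            ext x
            simp only [mem_filter, mem_insert]
            constructor
            · rintro ⟨rfl | h, h'⟩
              · exact absurd h' (lt_irrefl _)
              · exact h
            · exact fun h => ⟨Or.inr h, mem_range.1 (hA'.1 h)⟩
          rw [this, hA'.2]
          have : j + 1 - (r + 1) + r - j = 0 := by omega
          rw [this, pow_zero, pow_one]
        · refine prod_congr rfl fun i hi => ?_
          have : (insert j A).filter (· < i) = A.filter (· < i) := by
            rw [filter_insert, if_neg]
            exact not_lt.2 (mem_range.1 (hA'.1 hi)).le
          rw [this]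
          congr 3
          omega
      · intro A hA B hB h
        have hjA : j ∉ A := fun h => hj ((mem_powersetCard.1 hA).1 h)
        have hjB : j ∉ B := fun h => hj ((mem_powersetCard.1 hB).1 h)
        rw [← erase_insert hjA, ← erase_insert hjB, h]
  · rw [disjoint_left]
    intro A hA hA'
    obtain ⟨B, -, rfl⟩ := mem_image.1 hA'
    exact hj ((mem_powersetCard.1 hA).1 (mem_insert_self _ _))

/-- The recursion defining V_{j+1} matches, coefficient by coefficient, the recursion
`dicksonSum_succ_succ`. -/
theorem moorePoly_eq_sum (p : ℕ) [Fact p.Prime] [CharP R p] (a : ℕ → R) (j : ℕ) :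
    moorePoly p a j =
      ∑ r ∈ range (j + 1), C ((-1) ^ r * dicksonSum p a j r) * X ^ p ^ (j - r) := by
  induction j with
  | zero => simp [moorePoly]
  | succ j ih =>
    have hp := (Fact.out : p.Prime)
    rw [moorePoly, ih, sum_pow_char, mul_sum, sum_range_succ' _ (j + 1), sum_range_succ']
    have e0 : ((C ((-1) ^ 0 * dicksonSum p a j 0) * X ^ p ^ (j - 0)) ^ p : R[X]) =
        C ((-1) ^ 0 * dicksonSum p a (j + 1) 0) * X ^ p ^ (j + 1 - 0) := by
      simp [← pow_mul, ← pow_succ]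
    rw [e0, add_sub_right_comm]
    congr 1
    -- The sum may be extended to r = j because the form of degree j + 1 in j terms is zero.
    have h1 : ∑ r ∈ range j, ((C ((-1) ^ (r + 1) * dicksonSum p a j (r + 1)) *
        X ^ p ^ (j - (r + 1))) ^ p : R[X]) =
        ∑ r ∈ range (j + 1), C ((-1) ^ (r + 1) * dicksonSum p a j (r + 1) ^ p) *
          X ^ p ^ (j - r) := by
      rw [sum_range_succ, dicksonSum_of_lt p a (Nat.lt_succ_self j), zero_pow hp.ne_zero]
      rw [mul_zero, C_0, zero_mul, add_zero]
      refine sum_congr rfl fun r hr => ?_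
      have hr := mem_range.1 hr
      rw [mul_pow, ← C_pow, ← pow_mul, ← pow_succ, mul_pow, ← pow_mul, mul_comm (r + 1), pow_mul,
        neg_one_pow_char]
      congr 3
      omega
    rw [h1, ← sum_sub_distrib]
    refine sum_congr rfl fun r hr => ?_
    have hr := mem_range.1 hr
    rw [dicksonSum_succ_succ p a j r (by omega)]
    simp only [Nat.add_sub_add_right, C_mul, C_add, C_pow, C_neg, C_1]
    ring

theorem moorePoly_monic_natDegree (p : ℕ) [Fact p.Prime] [Nontrivial R] (a : ℕ → R) (j : ℕ) :
    (moorePoly p a j).Monic ∧ (moorePoly p a j).natDegree = p ^ j := by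
  induction j with
  | zero => exact ⟨monic_X, natDegree_X⟩
  | succ j ih =>
    have hp := (Fact.out : p.Prime)
    have hlt : (C (a j) * moorePoly p a j).natDegree < (moorePoly p a j ^ p).natDegree := by
      refine (natDegree_C_mul_le _ _).trans_lt ?_
      rw [ih.1.natDegree_pow, ih.2]
      exact lt_mul_of_one_lt_left (pow_pos hp.pos _) hp.one_lt
    refine ⟨(ih.1.pow p).sub_of_left ?_, ?_⟩
    · exact degree_lt_degree hlt
    · rw [moorePoly, natDegree_sub_eq_left_of_natDegree_lt hlt, ih.1.natDegree_pow, ih.2, pow_succ,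
        mul_comm]

theorem aeval_moorePoly_add (p : ℕ) [Fact p.Prime] {A : Type*} [CommRing A] [Algebra R A]
    [CharP A p] (a : ℕ → R) (j : ℕ) (z w : A) :
    aeval (z + w) (moorePoly p a j) = aeval z (moorePoly p a j) + aeval w (moorePoly p a j) := by
  induction j with
  | zero => simp [moorePoly]
  | succ j ih =>
    simp only [moorePoly, map_sub, map_pow, map_mul, aeval_C, ih, add_pow_char]
    ring

theorem aeval_moorePoly_smul (p : ℕ) [Fact p.Prime] {A : Type*} [CommRing A] [Algebra R A]
    [Algebra (ZMod p) A] (a : ℕ → R) (j : ℕ) (c : ZMod p) (z : A) :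
    aeval (algebraMap (ZMod p) A c * z) (moorePoly p a j) =
      algebraMap (ZMod p) A c * aeval z (moorePoly p a j) := by
  induction j with
  | zero => simp [moorePoly]
  | succ j ih =>
    simp only [moorePoly, map_sub, map_pow, map_mul, aeval_C, ih, mul_pow]
    rw [← map_pow (algebraMap (ZMod p) A) c, ZMod.pow_card]
    ring

/-- This isolates the first parameter a_0 in the inner factor X^p - a_0 X; the outer factor depends
only on the later parameters. -/
theorem moorePoly_succ_eq_comp (p : ℕ) (a : ℕ → R) (j : ℕ) :
    moorePoly p a (j + 1) = (moorePoly p (fun i => a (i + 1)) j).comp (moorePoly p a 1) := by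
  induction j with
  | zero => simp [moorePoly]
  | succ j ih =>
    rw [moorePoly, ih]
    simp [moorePoly]

/-- Homogenize ∏ (X - c) = X^p - X, the product over c in F_p. -/
theorem prod_sub_zmod_mul_field (p : ℕ) [Fact p.Prime] {K : Type*} [Field K]
    [Algebra (ZMod p) K] (z w : K) :
    ∏ c : ZMod p, (z - algebraMap (ZMod p) K c * w) = z ^ p - w ^ (p - 1) * z := by
  have hp := (Fact.out : p.Prime)
  rcases eq_or_ne w 0 with rfl | hw
  · simp [ZMod.card, zero_pow (Nat.sub_pos_of_lt hp.one_lt).ne']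
  have key : ∏ c : ZMod p, (X - C c) = (X ^ p - X : (ZMod p)[X]) := by
    have h := FiniteField.roots_X_pow_card_sub_X (ZMod p)
    have hd := FiniteField.X_pow_card_sub_X_natDegree_eq (ZMod p) hp.one_lt
    rw [ZMod.card] at h
    have := prod_multiset_X_sub_C_of_monic_of_roots_card_eq (p := (X ^ p - X : (ZMod p)[X]))
      (by
        refine (monic_X_pow p).sub_of_left ?_
        rw [degree_X, degree_X_pow]
        exact_mod_cast hp.one_lt) (by rw [h, hd]; simp [ZMod.card])
    rw [h] at this
    exact this
  have h := congrArg (aeval (z / w)) key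
  simp only [map_prod, map_sub, aeval_X, aeval_C, map_pow] at h
  have h2 : ∀ c : ZMod p, z - algebraMap (ZMod p) K c * w =
      w * (z / w - algebraMap (ZMod p) K c) := by
    intro c
    rw [mul_sub, mul_div_cancel₀ _ hw, mul_comm w]
  simp only [h2]
  rw [prod_mul_distrib, h, prod_const, card_univ, ZMod.card, mul_sub, div_pow,
    mul_div_cancel₀ _ (pow_ne_zero _ hw), ← mul_pow_sub_one hp.ne_zero w]
  congr 1
  field_simp

theorem prod_sub_zmod_mul (p : ℕ) [Fact p.Prime] {A : Type*} [CommRing A] [IsDomain A]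
    [Algebra (ZMod p) A] (z w : A) :
    ∏ c : ZMod p, (z - algebraMap (ZMod p) A c * w) = z ^ p - w ^ (p - 1) * z := by
  refine FaithfulSMul.algebraMap_injective A (FractionRing A) ?_
  have h := prod_sub_zmod_mul_field p (algebraMap A (FractionRing A) z) (algebraMap A _ w)
  simpa [← IsScalarTower.algebraMap_apply] using h

/-- The monic polynomial whose roots are the `F_p`-combinations of the first `j` of the `y_k`. -/
def spanPoly (p : ℕ) [Fact p.Prime] [Algebra (ZMod p) R] {n : ℕ} (y : Fin n → R) (j : ℕ) : R[X] :=
  ∏ c : Fin n → ZMod p with ∀ k : Fin n, j ≤ (k : ℕ) → c k = 0,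
    (X - C (∑ k, algebraMap (ZMod p) R (c k) * y k))

theorem spanPoly_zero (p : ℕ) [Fact p.Prime] [Algebra (ZMod p) R] {n : ℕ} (y : Fin n → R) :
    spanPoly p y 0 = X := by
  have : (univ.filter fun c : Fin n → ZMod p => ∀ k : Fin n, 0 ≤ (k : ℕ) → c k = 0) = {0} := by
    ext c
    simp [funext_iff]
  rw [spanPoly, this]
  simp

theorem spanPoly_succ_eq_prod (p : ℕ) [Fact p.Prime] [Algebra (ZMod p) R] {n : ℕ} (y : Fin n → R)
    (j : Fin n) :
    spanPoly p y (j + 1) =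
      ∏ a : ZMod p, (spanPoly p y j).comp (X - C (algebraMap (ZMod p) R a * y j)) := by
  simp only [spanPoly, Polynomial.prod_comp]
  rw [← prod_product']
  refine prod_nbij' (fun c => (c j, Function.update c j 0)) (fun x => Function.update x.2 j x.1)
    ?_ ?_ ?_ ?_ ?_
  · intro c hc
    simp only [mem_filter, mem_univ, true_and, mem_product] at hc ⊢
    intro k hk
    rcases eq_or_ne k j with rfl | h
    · simp
    · rw [Function.update_of_ne h]
      exact hc k (by have := Fin.val_ne_of_ne h; omega)
  · rintro ⟨a, c⟩ hc
    simp only [mem_filter, mem_univ, true_and, mem_product] at hc ⊢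
    intro k hk
    have h : k ≠ j := by rintro rfl; omega
    rw [Function.update_of_ne h]
    exact hc k (by omega)
  · intro c hc
    simp
  · rintro ⟨a, c⟩ hc
    simp only [mem_filter, mem_univ, true_and, mem_product] at hc
    simp [← hc j le_rfl]
  · intro c hc
    simp only [sub_comp, X_comp, C_comp, sub_sub, ← C_add]
    congr 2
    rw [← add_sum_erase _ _ (mem_univ j)]
    congr 1
    rw [← add_sum_erase _ _ (mem_univ j)]
    simp only [Function.update_self, map_zero, zero_mul, zero_add]
    refine sum_congr rfl fun k hk => ?_
    rw [Function.update_of_ne (ne_of_mem_erase hk)]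

/-- By additivity and F_p-linearity, V_j(X - c y_j) = V_j - c V_j(y_j), with y_j the variable of
zero-based index j. The product over c in F_p is then V_j^p - V_j(y_j)^{p-1} V_j, the recursion of
`moorePoly`. -/
theorem spanPoly_eq_moorePoly (p : ℕ) [Fact p.Prime] [IsDomain R] [Algebra (ZMod p) R] {n : ℕ}
    (y : Fin n → R) (a : ℕ → R)
    (ha : ∀ j : Fin n, a j = (spanPoly p y j).eval (y j) ^ (p - 1)) (j : ℕ) (hj : j ≤ n) :
    spanPoly p y j = moorePoly p a j := by
  have : CharP R p := charP_of_injective_algebraMap' (ZMod p) p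
  induction j with
  | zero => exact spanPoly_zero p y
  | succ j ih =>
    have ih := ih (by omega)
    have h := spanPoly_succ_eq_prod p y ⟨j, by omega⟩
    simp only at h
    rw [h, moorePoly]
    have h2 : ∀ c : ZMod p, (spanPoly p y j).comp (X - C (algebraMap (ZMod p) R c * y ⟨j, by omega⟩))
        = moorePoly p a j - algebraMap (ZMod p) R[X] c *
          C ((spanPoly p y j).eval (y ⟨j, by omega⟩)) := by
      intro c
      rw [ih, comp_eq_aeval, sub_eq_add_neg, aeval_moorePoly_add]
      have : -C (algebraMap (ZMod p) R c * y ⟨j, by omega⟩) =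
          algebraMap (ZMod p) R[X] (-c) * C (y ⟨j, by omega⟩) := by
        rw [map_neg, C_mul, neg_mul]; rfl
      rw [this, aeval_moorePoly_smul, ← comp_eq_aeval, comp_X, map_neg, neg_mul, ← sub_eq_add_neg]
      congr 2
      exact (aeval_algebraMap_apply R[X] _ _).trans (by rw [coe_aeval_eq_eval]; rfl)
    simp only [h2]
    rw [prod_sub_zmod_mul, ← C_pow, ha ⟨j, by omega⟩]

end Moore

/-! ### Extensions spanned by few elements, and independence of characters -/

section Spanning

open Polynomial Finset

variable {k S : Type*} [CommRing k] [CommRing S] [Algebra k S]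

/-- `C` lies in the `B`-span of `N` elements, one of which is `1`. -/
def SpannedBy (B C : Subalgebra k S) (N : ℕ) : Prop :=
  ∃ v : Fin N → S, (∃ i, v i = 1) ∧
    ∀ c ∈ C, ∃ b : Fin N → S, (∀ i, b i ∈ B) ∧ c = ∑ i, b i * v i

theorem SpannedBy.refl (B : Subalgebra k S) : SpannedBy B B 1 :=
  ⟨fun _ => 1, ⟨0, rfl⟩, fun c hc => ⟨fun _ => c, fun _ => hc, by simp⟩⟩

/-- Division with remainder by the monic q leaves only the powers x^e with e below its degree. -/
theorem SpannedBy.adjoin {B C : Subalgebra k S} {N : ℕ} (h : SpannedBy B C N) (x : S)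
    (q : C[X]) (hq : q.Monic) (hx : aeval x q = 0) (hd : q.natDegree ≠ 0) :
    SpannedBy B ((Algebra.adjoin C {x}).restrictScalars k) (N * q.natDegree) := by
  obtain ⟨v, ⟨i₀, hi₀⟩, hv⟩ := h
  refine ⟨fun i => v (finProdFinEquiv.symm i).1 * x ^ ((finProdFinEquiv.symm i).2 : ℕ),
    ⟨finProdFinEquiv (i₀, ⟨0, Nat.pos_of_ne_zero hd⟩), by simp [hi₀]⟩, ?_⟩
  intro c hc
  rw [Subalgebra.mem_restrictScalars, Algebra.adjoin_singleton_eq_range_aeval] at hc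
  obtain ⟨r, rfl⟩ := hc
  have hr : aeval x r = aeval x (r %ₘ q) := (aeval_modByMonic_eq_self_of_root hx).symm
  have hlt : (r %ₘ q).natDegree < q.natDegree :=
    natDegree_modByMonic_lt r hq (by rintro rfl; simp at hd)
  choose b hb hb' using fun e : Fin q.natDegree => hv _ ((r %ₘ q).coeff e).2
  refine ⟨fun i => b (finProdFinEquiv.symm i).2 (finProdFinEquiv.symm i).1, fun i => hb _ _, ?_⟩
  change aeval x r = _
  rw [hr, aeval_eq_sum_range' hlt, Finset.sum_range,
    ← finProdFinEquiv.sum_comp, Fintype.sum_prod_type_right]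
  refine sum_congr rfl fun e _ => ?_
  rw [Algebra.smul_def]
  change ((r %ₘ q).coeff e : S) * _ = _
  rw [hb' e, sum_mul]
  refine sum_congr rfl fun i _ => ?_
  simp [mul_assoc]

/-- With as many distinct endomorphisms over B as spanning elements v_i, the matrix (φ_g(v_i)) is
nonsingular by independence of characters. A fixed f = ∑ b_i v_i solves the same linear system as f
· 1, and 1 is one of the v_i, so f is the coefficient b_i at that place. -/
theorem SpannedBy.mem_of_fixed [IsDomain S] {B : Subalgebra k S} {N : ℕ}
    (h : SpannedBy B ⊤ N) (φ : Fin N → S →ₐ[k] S) (hφ : Function.Injective φ)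
    (hB : ∀ i, ∀ b ∈ B, φ i b = b) (f : S) (hf : ∀ i, φ i f = f) : f ∈ B := by
  obtain ⟨v, ⟨i₀, hi₀⟩, hv⟩ := h
  set M : Matrix (Fin N) (Fin N) S := Matrix.of fun g i => φ g (v i)
  have hM : M.det ≠ 0 := by
    intro h0
    -- A row relation would make ∑_g c_g φ_g vanish on all v_i, hence on all of S since each φ_g
    -- fixes B.
    obtain ⟨c, hc0, hc⟩ := Matrix.exists_vecMul_eq_zero_iff.2 h0
    have hli := (linearIndependent_monoidHom S S).comp (fun i => ((φ i : S →* S)))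
      (fun i j hij => hφ (AlgHom.ext fun x => DFunLike.congr_fun hij x))
    rw [Fintype.linearIndependent_iff] at hli
    refine hc0 (funext fun g => hli c ?_ g)
    funext x
    obtain ⟨b, hb, rfl⟩ := hv x trivial
    simp only [Finset.sum_apply, Pi.smul_apply, Function.comp_apply, smul_eq_mul, Pi.zero_apply]
    have : ∀ g, (φ g : S →* S) (∑ i, b i * v i) = ∑ i, b i * M g i := by
      intro g
      change φ g _ = _
      rw [map_sum]
      exact sum_congr rfl fun i _ => by rw [map_mul, hB g _ (hb i)]; rfl
    simp only [this, mul_sum]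
    rw [sum_comm]
    refine sum_eq_zero fun i _ => ?_
    have := congrFun hc i
    simp only [Matrix.vecMul, dotProduct, Pi.zero_apply] at this
    calc _ = b i * ∑ g, c g * M g i := by rw [mul_sum]; exact sum_congr rfl fun g _ => by ring
      _ = 0 := by rw [this, mul_zero]
  obtain ⟨b, hb, hfb⟩ := hv f trivial
  have hz := Matrix.eq_zero_of_mulVec_eq_zero hM (v := b - Pi.single i₀ f) (by
    rw [Matrix.mulVec_sub]
    funext g
    simp only [Pi.sub_apply, Matrix.mulVec, dotProduct, Pi.single_apply, mul_ite, mul_zero,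
      sum_ite_eq', mem_univ, if_true, Pi.zero_apply]
    have h1 : M g i₀ = 1 := by simp [M, hi₀]
    have h2 : ∑ i, M g i * b i = f := by
      conv_rhs => rw [← hf g, hfb, map_sum]
      exact sum_congr rfl fun i _ => by rw [map_mul, hB g _ (hb i), mul_comm]; rfl
    rw [h1, h2, one_mul, sub_self])
  have := congrFun hz i₀
  simp only [Pi.sub_apply, Pi.single_eq_same, Pi.zero_apply, sub_eq_zero] at this
  exact this ▸ hb i₀

end Spanning

/-! ### A lower bound for the order of the parabolic subgroup -/

section Card

open Matrix

/-- The first column maps GL_n to the p^n - 1 nonzero vectors, and each fibre embeds by translation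
in the stabilizer F of the first basis vector. The products of nonzero scalars with elements of F
are distinct elements of the parabolic. A lower bound suffices, since it supplies enough
automorphisms for `SpannedBy.mem_of_fixed`. -/
theorem card_parabolic_ge (p n : ℕ) [Fact p.Prime] (hn : 1 ≤ n) :
    (p - 1) * ∏ j ∈ Finset.Ico 1 n, (p ^ n - p ^ j) ≤ Nat.card (parabolic p n 1) := by
  classical
  have hp := (Fact.out : p.Prime)
  let i₀ : Fin n := ⟨0, by omega⟩
  let F : Finset (GL (Fin n) (ZMod p)) := Finset.univ.filter fun g => g.val.col i₀ = Pi.single i₀ 1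
  have h1 : Fintype.card (GL (Fin n) (ZMod p)) ≤ F.card * (p ^ n - 1) := by
    have hc : (Finset.univ.erase (0 : Fin n → ZMod p)).card = p ^ n - 1 := by
      rw [Finset.card_erase_of_mem (Finset.mem_univ _)]
      simp [ZMod.card]
    rw [← hc, ← Finset.card_univ]
    refine Finset.card_le_mul_card_image_of_maps_to (f := fun g => g.val.col i₀) ?_ _ ?_
    · intro g _
      refine Finset.mem_erase.2 ⟨fun h => ?_, Finset.mem_univ _⟩
      have := Matrix.det_eq_zero_of_column_eq_zero i₀ (fun i => congrFun h i)
      exact (((Matrix.isUnit_iff_isUnit_det _).1 g.isUnit).ne_zero) this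
    · intro v _
      rcases (Finset.univ.filter fun g : GL (Fin n) (ZMod p) => g.val.col i₀ = v).eq_empty_or_nonempty
        with h | ⟨g₀, hg₀⟩
      · rw [h]; simp
      · refine Finset.card_le_card_of_injOn (fun g => g₀⁻¹ * g) ?_ ?_
        · intro g hg
          simp only [Finset.coe_filter, Finset.mem_univ, true_and, Set.mem_ofPred_eq] at hg
          simp only [Finset.mem_filter, Finset.mem_univ, true_and] at hg₀
          simp only [F, Finset.coe_filter, Finset.mem_univ, true_and, Set.mem_ofPred_eq]
          have e : ∀ A B : Matrix (Fin n) (Fin n) (ZMod p), (A * B).col i₀ = A *ᵥ B.col i₀ :=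
            fun A B => by ext i; simp [Matrix.mul_apply, Matrix.mulVec, dotProduct]
          rw [Units.val_mul, e, hg, ← hg₀, ← e, Units.inv_mul]
          ext i
          simp [Matrix.one_apply, Pi.single_apply]
        · exact fun a _ b _ h => mul_left_cancel h
  have h2 : (p - 1) * F.card ≤ Nat.card (parabolic p n 1) := by
    have hc : (p - 1) * F.card = Nat.card ((ZMod p)ˣ × F) := by
      rw [Nat.card_prod]
      simp [ZMod.card_units_eq_totient, Nat.totient_prime hp]
    rw [hc]
    let s : (ZMod p)ˣ →* GL (Fin n) (ZMod p) := Units.map (Matrix.scalar (Fin n)).toMonoidHom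
    have hs : ∀ (c : (ZMod p)ˣ) (g : F) (i : Fin n), (s c * g.1).val i i₀ =
        if i = i₀ then (c : ZMod p) else 0 := by
      intro c g i
      have h := congrFun (Finset.mem_filter.1 g.2).2 i
      rw [Matrix.col_apply] at h
      simp [s, h, Pi.single_apply]
    have hm : ∀ x : (ZMod p)ˣ × F, s x.1 * x.2.1 ∈ parabolic p n 1 := by
      intro x
      rw [mem_parabolic]
      intro i j hi hj
      have hj : j = i₀ := Fin.ext (by simp only [i₀]; omega)
      rw [hj, hs, if_neg]
      rintro rfl
      simp [i₀] at hi
    refine Nat.card_le_card_of_injective (fun x => (⟨s x.1 * x.2.1, hm x⟩ : parabolic p n 1)) ?_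
    rintro ⟨c, g⟩ ⟨c', g'⟩ h
    have h : s c * g.1 = s c' * g'.1 := congrArg Subtype.val h
    have hcc : c = c' := by
      have h1 := hs c g i₀
      rw [h, hs] at h1
      simp only [if_true] at h1
      exact (Units.ext h1).symm
    subst hcc
    rw [Subtype.ext (mul_left_cancel h)]
  have h3 := Matrix.card_GL_field (𝔽 := ZMod p) n
  rw [Nat.card_eq_fintype_card, ZMod.card] at h3
  rw [h3, Fin.prod_univ_eq_prod_range (fun i => p ^ n - p ^ i), Finset.prod_range_eq_mul_Ico _ hn,
    pow_zero, mul_comm] at h1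
  have h4 : 0 < p ^ n - 1 := Nat.sub_pos_of_lt (Nat.one_lt_pow (by omega) hp.one_lt)
  exact (Nat.mul_le_mul_left _ (Nat.le_of_mul_le_mul_right h1 h4)).trans h2

end Card

/-! ### The polynomial ring over the algebra of the generators -/

section PolynomialPart

open Polynomial Finset

variable (p n : ℕ) [Fact p.Prime]

/-- The sequence `h_1 ^ (p - 1), …, h_n ^ (p - 1)`. -/
def hSeq (j : ℕ) : PolyPart p n := if h : j < n then hPoly p n ⟨j, h⟩ ^ (p - 1) else 0

theorem hPoly_eq_eval (j : Fin n) :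
    hPoly p n j = (spanPoly p (MvPolynomial.X : Fin n → PolyPart p n) j).eval (MvPolynomial.X j) := by
  simp only [hPoly, spanPoly, eval_prod, eval_sub, eval_X, eval_C, MvPolynomial.algebraMap_eq]
  rfl

theorem spanPoly_X_eq (j : ℕ) (hj : j ≤ n) :
    spanPoly p (MvPolynomial.X : Fin n → PolyPart p n) j = moorePoly p (hSeq p n) j :=
  spanPoly_eq_moorePoly p _ _ (fun j => by simp [hSeq, hPoly_eq_eval]) j hj

theorem linearForm_ne_zero (j : Fin n) (c : Fin n → ZMod p) (hc : c j = 0) :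
    (MvPolynomial.X j - ∑ k, MvPolynomial.C (c k) * MvPolynomial.X k : PolyPart p n) ≠ 0 := by
  intro h
  have := congrArg (MvPolynomial.eval (Pi.single j (1 : ZMod p))) h
  simp [Pi.single_apply, hc] at this

theorem hPoly_ne_zero (j : Fin n) : hPoly p n j ≠ 0 :=
  prod_ne_zero_iff.2 fun c hc => linearForm_ne_zero p n j c ((mem_filter.1 hc).2 j le_rfl)

theorem hPoly_zero (hn : 0 < n) : hPoly p n ⟨0, hn⟩ = MvPolynomial.X ⟨0, hn⟩ := by
  rw [hPoly_eq_eval, spanPoly_zero, eval_X]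

theorem dParabolic_eq (i : ℕ) :
    dParabolic p n 1 i = dicksonSum p (fun j => if j < 1 then 0 else hSeq p n j) n (n - i) := by
  rw [dParabolic, dicksonForm, map_sum, dicksonSum]
  have h : (range n).powersetCard (n - i) = ((univ : Finset (Fin n)).powersetCard (n - i)).map
      (mapEmbedding Fin.valEmbedding).toEmbedding := by
    have hr : range n = (univ : Finset (Fin n)).map Fin.valEmbedding := by
      ext i
      simp
    rw [hr, powersetCard_map]
  rw [h, sum_map]
  refine sum_congr rfl fun A hA => ?_
  rw [map_prod]
  simp only [RelEmbedding.coe_toEmbedding, mapEmbedding_apply, prod_map]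
  refine prod_congr rfl fun j hj => ?_
  have hf : ((A.map Fin.valEmbedding).filter (· < (j : ℕ))).card = (A.filter (· < j)).card := by
    rw [filter_map, card_map]
    rfl
  simp only [map_pow, MvPolynomial.aeval_X, Fin.valEmbedding_apply, hf]
  congr 1
  simp [hSeq]

/-- The algebra generated by the polynomial generators. -/
abbrev polyGenAlg : Subalgebra (ZMod p) (PolyPart p n) :=
  Algebra.adjoin (ZMod p) (Set.range (polyGen p n))

theorem hSeq_zero_mem (hn : 0 < n) : hSeq p n 0 ∈ polyGenAlg p n := by
  refine Algebra.subset_adjoin ⟨⟨0, hn⟩, ?_⟩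
  simp [polyGen, hSeq, hn]

/-- For 0 < r < n this is a generator. The form with r = n vanishes because its only product
contains the first term, which has been set to 0. -/
theorem dicksonSum_mem (r : ℕ) :
    dicksonSum p (fun j => if j < 1 then 0 else hSeq p n j) n r ∈ polyGenAlg p n := by
  rcases Nat.eq_zero_or_pos n with rfl | hn
  · rcases Nat.eq_zero_or_pos r with rfl | hr
    · rw [dicksonSum_zero]; exact one_mem _
    · rw [dicksonSum_of_lt _ _ hr]; exact zero_mem _
  rcases lt_trichotomy r n with h | rfl | h
  · rcases Nat.eq_zero_or_pos r with rfl | hr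
    · rw [dicksonSum_zero]; exact one_mem _
    · refine Algebra.subset_adjoin ⟨⟨n - r, by omega⟩, ?_⟩
      rw [polyGen, if_neg (by simp; omega), dParabolic_eq]
      congr 1
      simp
      omega
  · rw [dicksonSum]
    convert zero_mem (polyGenAlg p r)
    refine sum_eq_zero fun A hA => ?_
    rw [mem_powersetCard] at hA
    have : A = range r := eq_of_subset_of_card_le hA.1 (by rw [hA.2, card_range])
    refine prod_eq_zero (i := 0) (by rw [this]; simpa using hn) ?_
    rw [if_pos (by omega), zero_pow (pow_pos (Fact.out : p.Prime).pos _).ne']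
  · rw [dicksonSum_of_lt _ _ h]; exact zero_mem _

/-- With the first parameter set to 0, the polynomial V_n becomes W(X^p), whose coefficients are the
forms d_{n,i}(I) up to sign. -/
theorem hSeq_succ_moorePoly_lifts :
    moorePoly p (fun i => hSeq p n (i + 1)) (n - 1) ∈
      lifts (algebraMap (polyGenAlg p n) (PolyPart p n)) := by
  have hp := (Fact.out : p.Prime)
  rcases Nat.eq_zero_or_pos n with rfl | hn
  · exact X_mem_lifts _
  obtain ⟨m, rfl⟩ : ∃ m, n = m + 1 := ⟨n - 1, by omega⟩
  simp only [Nat.add_sub_cancel]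
  have h := moorePoly_succ_eq_comp p (fun j => if j < 1 then 0 else hSeq p (m + 1) j) m
  have h1 : moorePoly p (fun j => if j < 1 then 0 else hSeq p (m + 1) j) 1 = X ^ p := by
    simp [moorePoly]
  simp only [add_lt_iff_neg_right, not_lt_zero, if_false] at h
  rw [h1, ← expand_eq_comp_X_pow] at h
  rw [lifts_iff_coeff_lifts]
  intro t
  rw [← coeff_expand_mul hp.pos, ← h, moorePoly_eq_sum, finsetSum_coeff]
  simp only [coeff_C_mul, coeff_X_pow, mul_ite, mul_one, mul_zero]
  have hmem : ∀ x ∈ polyGenAlg p (m + 1), x ∈ Set.range (algebraMap (polyGenAlg p (m + 1))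
    (PolyPart p (m + 1))) := fun x hx => ⟨⟨x, hx⟩, rfl⟩
  refine hmem _ (sum_mem fun r _ => ?_)
  split_ifs
  · exact mul_mem (pow_mem (neg_mem (one_mem _)) _) (dicksonSum_mem p (m + 1) r)
  · exact zero_mem _

theorem spanPoly_top_lifts (hn : 0 < n) :
    spanPoly p (MvPolynomial.X : Fin n → PolyPart p n) n ∈
      lifts (algebraMap (polyGenAlg p n) (PolyPart p n)) := by
  rw [spanPoly_X_eq p n n le_rfl]
  obtain ⟨q, hq⟩ := hSeq_succ_moorePoly_lifts p n
  obtain ⟨m, rfl⟩ : ∃ m, n = m + 1 := ⟨n - 1, by omega⟩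
  rw [moorePoly_succ_eq_comp]
  simp only [Nat.add_sub_cancel] at hq
  refine ⟨q.comp (X ^ p - C ⟨_, hSeq_zero_mem p (m + 1) hn⟩ * X), ?_⟩
  rw [coe_mapRingHom] at hq ⊢
  rw [map_comp, hq]
  simp [moorePoly]

/-- The algebra generated by the polynomial generators and the first `j` variables. -/
def partialAlg (j : ℕ) : Subalgebra (ZMod p) (PolyPart p n) :=
  Algebra.adjoin (ZMod p)
    (Set.range (polyGen p n) ∪ MvPolynomial.X '' {i : Fin n | (i : ℕ) < j})

theorem partialAlg_zero : partialAlg p n 0 = polyGenAlg p n := by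
  simp [partialAlg]

theorem partialAlg_top : partialAlg p n n = ⊤ := by
  rw [eq_top_iff, ← MvPolynomial.adjoin_range_X]
  refine Algebra.adjoin_mono ?_
  rintro _ ⟨i, rfl⟩
  exact Or.inr ⟨i, i.2, rfl⟩

theorem partialAlg_succ (j : Fin n) :
    partialAlg p n (j + 1) =
      (Algebra.adjoin (partialAlg p n j) {MvPolynomial.X j}).restrictScalars (ZMod p) := by
  rw [partialAlg, partialAlg, ← Algebra.adjoin_union_eq_adjoin_adjoin, Set.union_assoc]
  congr 2
  ext x
  simp only [Set.mem_image, Set.mem_ofPred_eq, Set.mem_union, Set.mem_singleton_iff]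
  constructor
  · rintro ⟨i, hi, rfl⟩
    rcases Nat.lt_succ_iff_lt_or_eq.1 hi with h | h
    · exact Or.inl ⟨i, h, rfl⟩
    · exact Or.inr (by rw [Fin.ext h])
  · rintro (⟨i, hi, rfl⟩ | rfl)
    · exact ⟨i, by omega, rfl⟩
    · exact ⟨j, by omega, rfl⟩

theorem spanPoly_lifts (j : ℕ) :
    spanPoly p (MvPolynomial.X : Fin n → PolyPart p n) j ∈
      lifts (algebraMap (partialAlg p n j) (PolyPart p n)) := by
  refine prod_mem fun c hc => ?_
  suffices h : ∑ k, algebraMap (ZMod p) (PolyPart p n) (c k) * MvPolynomial.X k ∈ partialAlg p n j by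
    refine ⟨X - C ⟨_, h⟩, ?_⟩
    rw [coe_mapRingHom, Polynomial.map_sub, map_X, map_C]
    rfl
  refine sum_mem fun k _ => ?_
  rcases lt_or_ge (k : ℕ) j with h | h
  · exact mul_mem (Subalgebra.algebraMap_mem _ _) (Algebra.subset_adjoin (Or.inr ⟨k, h, rfl⟩))
  · rw [(mem_filter.1 hc).2 k h, map_zero, zero_mul]
    exact zero_mem _

theorem lifts_mono {B C : Subalgebra (ZMod p) (PolyPart p n)} (h : B ≤ C) {f : (PolyPart p n)[X]}
    (hf : f ∈ lifts (algebraMap B (PolyPart p n))) : f ∈ lifts (algebraMap C (PolyPart p n)) := by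
  rw [lifts_iff_coeff_lifts] at hf ⊢
  intro t
  obtain ⟨b, hb⟩ := hf t
  exact ⟨⟨b.1, h b.2⟩, hb⟩

/-- Adjoin the variables one at a time. The first satisfies an equation of degree p - 1. Each later
one is a root of V_n divided by the V of the preceding variables; numerator and denominator both
have coefficients in the algebra already built. -/
theorem spannedBy_partialAlg (hn : 0 < n) (j : ℕ) (hj : j + 1 ≤ n) :
    SpannedBy (polyGenAlg p n) (partialAlg p n (j + 1))
      ((p - 1) * ∏ i ∈ Ico 1 (j + 1), (p ^ n - p ^ i)) := by
  have hp := (Fact.out : p.Prime)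
  induction j with
  | zero =>
    have h0 := SpannedBy.refl (polyGenAlg p n)
    have := h0.adjoin (MvPolynomial.X ⟨0, hn⟩)
      (X ^ (p - 1) - C ⟨hSeq p n 0, hSeq_zero_mem p n hn⟩)
      (monic_X_pow_sub_C _ (Nat.sub_pos_of_lt hp.one_lt).ne')
      (by simp [hSeq, hn, hPoly_zero])
      (by rw [natDegree_X_pow_sub_C]; exact (Nat.sub_pos_of_lt hp.one_lt).ne')
    rw [natDegree_X_pow_sub_C, one_mul] at this
    have e := partialAlg_succ p n ⟨0, hn⟩
    rw [partialAlg_zero] at e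
    simp only [zero_add] at e
    simpa [e] using this
  | succ j ih =>
    have ih := ih (by omega)
    let V := fun j => spanPoly p (MvPolynomial.X : Fin n → PolyPart p n) j
    have hV : ∀ i ≤ n, (V i).Monic ∧ (V i).natDegree = p ^ i := fun i hi => by
      have := moorePoly_monic_natDegree p (hSeq p n) i
      rwa [← spanPoly_X_eq p n i hi] at this
    let x : Fin n := ⟨j + 1, by omega⟩
    obtain ⟨w, hw, -, hwm⟩ := lifts_and_natDegree_eq_and_monic
      (lifts_mono p n (C := partialAlg p n (j + 1))
        (Algebra.adjoin_mono Set.subset_union_left) (spanPoly_top_lifts p n hn)) (hV n le_rfl).1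
    obtain ⟨v, hv, -, hvm⟩ := lifts_and_natDegree_eq_and_monic (spanPoly_lifts p n (j + 1))
      (hV (j + 1) (by omega)).1
    have hdvd : V (j + 1) ∣ V n := prod_dvd_prod_of_subset _ _ _ fun c hc => by
      simp only [mem_filter, mem_univ, true_and] at hc ⊢
      exact fun k hk => absurd hk (not_le.2 k.2)
    obtain ⟨N, hN⟩ := hdvd
    -- Dividing by a monic polynomial stays over the smaller algebra, so the quotient N also has its
    -- coefficients there.
    have hq : (w /ₘ v).map (algebraMap _ (PolyPart p n)) = N := by
      rw [map_divByMonic _ hvm, hw, hv]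
      change V n /ₘ V (j + 1) = N
      rw [hN, mul_divByMonic_cancel_left _ (hV (j + 1) (by omega)).1]
    have hNm : N.Monic := (hV (j + 1) (by omega)).1.of_mul_monic_left (hN ▸ (hV n le_rfl).1)
    have hNd : N.natDegree = p ^ n - p ^ (j + 1) := by
      have := (hV (j + 1) (by omega)).1.natDegree_mul hNm
      rw [← hN, (hV n le_rfl).2, (hV (j + 1) (by omega)).2] at this
      omega
    have hinj : Function.Injective (algebraMap (partialAlg p n (j + 1)) (PolyPart p n)) :=
      Subtype.val_injective
    have hqm : (w /ₘ v).Monic := monic_of_injective hinj (hq ▸ hNm)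
    have hqd : (w /ₘ v).natDegree = p ^ n - p ^ (j + 1) := by
      rw [← hNd, ← hq, natDegree_map_eq_of_injective hinj]
    have hroot : aeval (MvPolynomial.X x : PolyPart p n) (w /ₘ v) = 0 := by
      rw [← eval_map_algebraMap, hq]
      have h1 : (V n).eval (MvPolynomial.X x) = 0 := by
        simp only [V, spanPoly, eval_prod]
        refine prod_eq_zero (i := Pi.single x 1) ?_ ?_
        · simp only [mem_filter, mem_univ, true_and]
          exact fun k hk => absurd hk (not_le.2 k.2)
        · simp [Pi.single_apply, ite_mul]
      -- The new variable is not a root of the denominator: the value there is h at that variable,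
      -- which is nonzero. So it is a root of N.
      have h2 : (V (j + 1)).eval (MvPolynomial.X x) ≠ 0 := by
        have := hPoly_ne_zero p n x
        rwa [hPoly_eq_eval] at this
      rw [hN, eval_mul] at h1
      exact (mul_eq_zero.1 h1).resolve_left h2
    have := ih.adjoin (MvPolynomial.X x) _ hqm hroot (by
      rw [hqd]
      exact (Nat.sub_pos_of_lt (Nat.pow_lt_pow_right hp.one_lt (by omega))).ne')
    rw [hqd, mul_assoc, ← prod_Ico_succ_top (by omega)] at this
    rwa [partialAlg_succ p n x]

end PolynomialPart

/-! ### The invariants in the polynomial ring -/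

section PolynomialInvariants

open Polynomial Finset

variable (p n : ℕ) [Fact p.Prime]

theorem eval_actPoly_X (g : GL (Fin n) (ZMod p)) (i k : Fin n) :
    MvPolynomial.eval (Pi.single i (1 : ZMod p)) (actPoly p n g (MvPolynomial.X k)) = g.val i k := by
  simp [actPoly, Pi.single_apply]

theorem actPoly_injective : Function.Injective (actPoly p n) := fun g g' h => by
  ext i k
  rw [← eval_actPoly_X, h, eval_actPoly_X]

theorem actPoly_linearForm (g : GL (Fin n) (ZMod p)) (c : Fin n → ZMod p) :
    actPoly p n g (∑ k, MvPolynomial.C (c k) * MvPolynomial.X k) =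
      ∑ i, MvPolynomial.C (g.val.mulVec c i) * MvPolynomial.X i := by
  simp only [actPoly, map_sum, map_mul, MvPolynomial.aeval_X, MvPolynomial.algHom_C,
    MvPolynomial.algebraMap_eq, Matrix.mulVec, dotProduct, mul_sum, sum_mul]
  rw [sum_comm]
  refine sum_congr rfl fun i _ => sum_congr rfl fun k _ => ?_
  ring

/-- The whole linear group permutes the roots, which are all the linear forms. -/
theorem map_actPoly_spanPoly_top (g : GL (Fin n) (ZMod p)) :
    (spanPoly p (MvPolynomial.X : Fin n → PolyPart p n) n).map (actPoly p n g : PolyPart p n →+* _) =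
      spanPoly p (MvPolynomial.X : Fin n → PolyPart p n) n := by
  rw [spanPoly, Polynomial.map_prod]
  have hb : Function.Bijective g.val.mulVec :=
    Finite.injective_iff_bijective.1 (Matrix.mulVec_injective_of_isUnit g.isUnit)
  refine prod_nbij g.val.mulVec ?_ hb.1.injOn ?_ fun c _ => ?_
  · intro c _
    simp only [mem_filter, mem_univ, true_and]
    exact fun k hk => absurd hk (not_le.2 k.2)
  · intro c _
    obtain ⟨d, rfl⟩ := hb.2 c
    refine ⟨d, ?_, rfl⟩
    simp only [coe_filter, mem_univ, true_and, Set.mem_ofPred_eq]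
    exact fun k hk => absurd hk (not_le.2 k.2)
  · rw [Polynomial.map_sub, map_X, map_C]
    congr 2
    exact actPoly_linearForm p n g c

theorem moorePoly_eq_comp {R : Type*} [CommRing R] (q : ℕ) (a : ℕ → R) {m : ℕ} (hm : 0 < m) :
    moorePoly q a m = (moorePoly q (fun i => a (i + 1)) (m - 1)).comp (moorePoly q a 1) := by
  obtain ⟨m, rfl⟩ : ∃ l, m = l + 1 := ⟨m - 1, by omega⟩
  exact moorePoly_succ_eq_comp q a m

theorem actPoly_X_zero {g : GL (Fin n) (ZMod p)} (hg : g ∈ parabolic p n 1) (hn : 0 < n) :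
    ∃ a : (ZMod p)ˣ, a = g.val ⟨0, hn⟩ ⟨0, hn⟩ ∧
      actPoly p n g (MvPolynomial.X ⟨0, hn⟩) = MvPolynomial.C (a : ZMod p) * MvPolynomial.X ⟨0, hn⟩ := by
  rw [mem_parabolic] at hg
  have h0 : g.val ⟨0, hn⟩ ⟨0, hn⟩ ≠ 0 := by
    intro h
    have := Matrix.det_eq_zero_of_column_eq_zero (A := g.val) ⟨0, hn⟩ (fun i => by
      rcases Nat.eq_zero_or_pos i with hi | hi
      · rw [show i = ⟨0, hn⟩ from Fin.ext hi, h]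
      · exact hg i _ hi (by simp))
    exact ((Matrix.isUnit_iff_isUnit_det _).1 g.isUnit).ne_zero this
  refine ⟨Units.mk0 _ h0, rfl, ?_⟩
  rw [actPoly, MvPolynomial.aeval_X, sum_eq_single ⟨0, hn⟩]
  · rfl
  · intro i _ hi
    rw [hg i _ (Nat.pos_of_ne_zero fun h => hi (Fin.ext h)) (by simp), map_zero, zero_mul]
  · simp

theorem actPoly_hSeq_zero {g : GL (Fin n) (ZMod p)} (hg : g ∈ parabolic p n 1) :
    actPoly p n g (hSeq p n 0) = hSeq p n 0 := by
  rw [hSeq]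
  split_ifs with hn
  · obtain ⟨a, -, ha⟩ := actPoly_X_zero p n hg hn
    rw [hPoly_zero, map_pow, ha, mul_pow, ← map_pow, ZMod.pow_card_sub_one_eq_one a.ne_zero,
      map_one, one_mul]
  · simp

/-- V_n = W ∘ V_1 with V_n and V_1 both fixed by g, so (gW - W) ∘ V_1 = 0; as V_1 has degree p, it
can be cancelled. -/
theorem map_actPoly_hSeq_succ_moorePoly {g : GL (Fin n) (ZMod p)} (hg : g ∈ parabolic p n 1) :
    (moorePoly p (fun i => hSeq p n (i + 1)) (n - 1)).map (actPoly p n g : PolyPart p n →+* _) =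
      moorePoly p (fun i => hSeq p n (i + 1)) (n - 1) := by
  rcases Nat.eq_zero_or_pos n with rfl | hn
  · simp [moorePoly]
  have hV := map_actPoly_spanPoly_top p n g
  rw [spanPoly_X_eq p n n le_rfl] at hV
  have hc := moorePoly_eq_comp p (hSeq p n) hn
  have h1 : (moorePoly p (hSeq p n) 1).map (actPoly p n g : PolyPart p n →+* _) =
      moorePoly p (hSeq p n) 1 := by
    simp [moorePoly, actPoly_hSeq_zero p n hg]
  rw [hc, map_comp, h1, ← sub_eq_zero, ← sub_comp] at hV
  rw [← sub_eq_zero]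
  rcases comp_eq_zero_iff.1 hV with h | ⟨-, h⟩
  · exact h
  · have := (moorePoly_monic_natDegree p (hSeq p n) 1).2
    rw [h, natDegree_C, pow_one] at this
    exact absurd this.symm (Fact.out : p.Prime).ne_zero

theorem actPoly_dParabolic {g : GL (Fin n) (ZMod p)} (hg : g ∈ parabolic p n 1) (hn : 0 < n) (i : ℕ) :
    actPoly p n g (dParabolic p n 1 i) = dParabolic p n 1 i := by
  have hp := (Fact.out : p.Prime)
  have h := map_actPoly_hSeq_succ_moorePoly p n hg
  set b : ℕ → PolyPart p n := fun j => if j < 1 then 0 else hSeq p n j with hb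
  have he : moorePoly p b n =
      expand _ p (moorePoly p (fun i => hSeq p n (i + 1)) (n - 1)) := by
    rw [moorePoly_eq_comp p b hn, expand_eq_comp_X_pow]
    have h1 : moorePoly p b 1 = X ^ p := by simp [moorePoly, hb]
    rw [h1]
    simp [hb]
  have hm : (moorePoly p b n).map (actPoly p n g : PolyPart p n →+* _) = moorePoly p b n := by
    rw [he, map_expand, h]
  rw [dParabolic_eq]
  -- Distinct r give distinct exponents p^{n-r}, so each Dickson sum can be read off from one
  -- coefficient.
  have hcoeff : ∀ r ≤ n, (moorePoly p b n).coeff (p ^ (n - r)) = (-1) ^ r * dicksonSum p b n r := by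
    intro r hr
    rw [moorePoly_eq_sum, finsetSum_coeff, sum_eq_single r]
    · rw [coeff_C_mul, coeff_X_pow, if_pos rfl, mul_one]
    · intro s hs hsr
      rw [coeff_C_mul, coeff_X_pow, if_neg, mul_zero]
      intro h
      have := Nat.pow_right_injective hp.two_le h
      have := mem_range.1 hs
      omega
    · intro h
      exact absurd (mem_range.2 (by omega)) h
  have h2 := congrArg (fun f : (PolyPart p n)[X] => f.coeff (p ^ (n - (n - i)))) hm
  simp only [coeff_map, hcoeff _ (Nat.sub_le n i)] at h2
  rw [map_mul, map_pow, map_neg, map_one] at h2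
  exact mul_left_cancel₀ (pow_ne_zero _ (neg_ne_zero.2 one_ne_zero)) h2

theorem polyGen_mem (hn : 0 < n) (i : Fin n) :
    polyGen p n i ∈ polyInvariants p n (parabolic p n 1) := by
  rw [mem_polyInvariants]
  intro g hg
  rw [polyGen]
  split_ifs with h
  · have := actPoly_hSeq_zero p n hg
    simp only [hSeq, hn, dif_pos] at this
    have hi : i = ⟨0, hn⟩ := Fin.ext h
    rwa [hi]
  · exact actPoly_dParabolic p n hg hn i

theorem spannedBy_polyGenAlg (hn : 0 < n) :
    SpannedBy (polyGenAlg p n) ⊤ ((p - 1) * ∏ i ∈ Ico 1 n, (p ^ n - p ^ i)) := by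
  have := spannedBy_partialAlg p n hn (n - 1) (by omega)
  rwa [Nat.sub_add_cancel hn, partialAlg_top] at this

theorem adjoin_polyGen_eq (hn : 0 < n) :
    polyGenAlg p n = polyInvariants p n (parabolic p n 1) := by
  have hle : polyGenAlg p n ≤ polyInvariants p n (parabolic p n 1) := by
    refine Algebra.adjoin_le ?_
    rintro _ ⟨i, rfl⟩
    exact polyGen_mem p n hn i
  refine le_antisymm hle fun f hf => ?_
  classical
  have hcard := card_parabolic_ge p n hn
  rw [Nat.card_eq_fintype_card, ← Fintype.card_fin (_ * _)] at hcard
  obtain ⟨e⟩ := Function.Embedding.nonempty_of_card_le hcard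
  refine (spannedBy_polyGenAlg p n hn).mem_of_fixed (fun i => actPoly p n (e i).1) ?_ ?_ f ?_
  · exact fun i j h => e.injective (Subtype.ext (actPoly_injective p n h))
  · exact fun i b hb => (mem_polyInvariants p n _ b).1 (hle hb) _ (e i).2
  · exact fun i => (mem_polyInvariants p n _ f).1 hf _ (e i).2

/-- The polynomial ring is finite, hence algebraic, over the algebra of these n elements, and n is
its transcendence degree. -/
theorem algebraicIndependent_polyGen (hn : 0 < n) :
    AlgebraicIndependent (ZMod p) (polyGen p n) := by
  obtain ⟨v, -, hv⟩ := spannedBy_polyGenAlg p n hn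
  have : Module.Finite (polyGenAlg p n) (PolyPart p n) := by
    refine ⟨Submodule.fg_def.2 ⟨Set.range v, Set.finite_range v, ?_⟩⟩
    refine eq_top_iff.2 fun c _ => ?_
    obtain ⟨b, hb, rfl⟩ := hv c trivial
    exact sum_mem fun i _ => Submodule.smul_mem _ (⟨b i, hb i⟩ : polyGenAlg p n)
      (Submodule.subset_span ⟨i, rfl⟩)
  have : Algebra.IsIntegral (polyGenAlg p n) (PolyPart p n) := Algebra.IsIntegral.of_finite _ _
  have : Algebra.IsAlgebraic (polyGenAlg p n) (PolyPart p n) := inferInstance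
  refine (Algebra.IsAlgebraic.isTranscendenceBasis_of_le_trdeg_of_finite (ZMod p) (polyGen p n)
    ?_).1
  rw [MvPolynomial.trdeg_of_isDomain]
  simp

end PolynomialInvariants

/-! ### Reduced powers and the Bockstein on invariants -/

section Steenrod

open Polynomial Finset

variable (p n : ℕ) [Fact p.Prime]

theorem sum_C_mul_X_pow (c : Fin n → ZMod p) (t : ℕ) :
    (∑ i, MvPolynomial.C (c i) * MvPolynomial.X i : PolyPart p n) ^ p ^ t =
      ∑ i, MvPolynomial.C (c i) * MvPolynomial.X i ^ p ^ t := by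
  rw [sum_pow_char_pow]
  refine sum_congr rfl fun i _ => ?_
  rw [mul_pow, ← map_pow, ZMod.pow_card_pow]

/-- The map y ↦ y + y^p T is F_p-linear on linear forms, so it commutes with linear substitutions.
-/
theorem totalPower_actPoly (g : GL (Fin n) (ZMod p)) (f : PolyPart p n) :
    totalPower p n (actPoly p n g f) = Polynomial.mapAlgHom (actPoly p n g) (totalPower p n f) := by
  suffices h : (totalPower p n).comp (actPoly p n g) =
      (Polynomial.mapAlgHom (actPoly p n g)).comp (totalPower p n) from DFunLike.congr_fun h f
  refine MvPolynomial.algHom_ext fun k => ?_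
  have h := sum_C_mul_X_pow p n (fun i => g.val i k) 1
  rw [pow_one] at h
  have e1 : actPoly p n g (MvPolynomial.X k) =
      ∑ i, MvPolynomial.C (g.val i k) * MvPolynomial.X i := MvPolynomial.aeval_X _ _
  have e2 : ∀ i, totalPower p n (MvPolynomial.X i) =
      C (MvPolynomial.X i) + C (MvPolynomial.X i ^ p) * X := fun i => MvPolynomial.aeval_X _ _
  rw [AlgHom.comp_apply, AlgHom.comp_apply, e1, e2, coe_mapAlgHom, Polynomial.map_add,
    Polynomial.map_mul, map_X, map_C, map_C, RingHom.coe_coe, map_pow, e1, h]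
  simp only [map_sum, map_mul, e2, MvPolynomial.algHom_C, mul_add, sum_add_distrib, sum_mul,
    mul_assoc]
  rfl

theorem powerPoly_mem (m : ℕ) (f : PolyPart p n) (G : Subgroup (GL (Fin n) (ZMod p)))
    (hf : f ∈ polyInvariants p n G) : powerPoly p n m f ∈ polyInvariants p n G := by
  rw [mem_polyInvariants] at hf ⊢
  intro g hg
  have h := congrArg (fun q => q.coeff m) (totalPower_actPoly p n g f)
  rw [hf g hg] at h
  simp only [coe_mapAlgHom, coeff_map] at h
  exact h.symm

theorem steenrodClosed_map_includeLeft (B : Subalgebra (ZMod p) (PolyPart p n))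
    (hB : ∀ m, ∀ f ∈ B, powerPoly p n m f ∈ B) :
    SteenrodClosed p n (B.map (Algebra.TensorProduct.includeLeft)) := by
  constructor
  · rintro _ ⟨f, hf, rfl⟩
    have h : bockstein p n (f ⊗ₜ 1) = 0 := by
      simp [bockstein, CliffordAlgebra.contractLeft_one, LinearMap.sum_apply]
    exact h ▸ zero_mem (B.map _)
  · rintro m _ ⟨f, hf, rfl⟩
    exact ⟨_, hB m f hf, by simp [powerCoh]⟩

end Steenrod

/-! ### Substitutions in the exterior variables -/

section Substitution

open Finset

variable (p n : ℕ)

/-- The monomials in the `x_i` as a basis of `H^*(V)` over `F_p[y]`. -/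
def cohBasis : Module.Basis (Finset (Fin n)) (PolyPart p n) (Coh p n) :=
  (Pi.basisFun (ZMod p) (Fin n)).ExteriorAlgebra.baseChange (PolyPart p n)

theorem cohBasis_eq_tmul (J : Finset (Fin n)) :
    cohBasis p n J = 1 ⊗ₜ (Pi.basisFun (ZMod p) (Fin n)).ExteriorAlgebra J :=
  Module.Basis.baseChange_apply _ _ _

theorem extBasis_eq_prod (J : Finset (Fin n)) :
    (Pi.basisFun (ZMod p) (Fin n)).ExteriorAlgebra J =
      (List.ofFn fun c : Fin J.card =>
        ExteriorAlgebra.ι (ZMod p) (Pi.single (J.orderEmbOfFin rfl c) (1 : ZMod p))).prod := by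
  refine (ExteriorAlgebra.basis_apply_ofCard _ rfl).trans ((ExteriorAlgebra.ιMulti_apply _).trans ?_)
  simp only [Function.comp_apply, Pi.basisFun_apply]
  rfl

theorem cohBasis_eq_prod (J : Finset (Fin n)) :
    cohBasis p n J = (List.ofFn fun c : Fin J.card => xCl p n (J.orderEmbOfFin rfl c)).prod := by
  rw [cohBasis_eq_tmul, extBasis_eq_prod]
  change Algebra.TensorProduct.includeRight _ = _
  rw [map_list_prod, List.map_ofFn]
  rfl

theorem cohBasis_empty : cohBasis p n ∅ = 1 := by
  rw [cohBasis_eq_prod]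
  simp

theorem orderEmbOfFin_singleton (i : Fin n) (c : Fin (card {i})) :
    (({i} : Finset (Fin n)).orderEmbOfFin rfl c) = i :=
  mem_singleton.1 (orderEmbOfFin_mem ({i} : Finset (Fin n)) rfl c)

theorem cohBasis_singleton (i : Fin n) : cohBasis p n {i} = xCl p n i := by
  rw [cohBasis_eq_prod]
  simp only [orderEmbOfFin_singleton]
  simp

theorem xCl_mul_self (i : Fin n) : xCl p n i * xCl p n i = 0 := by
  rw [xCl, Algebra.TensorProduct.tmul_mul_tmul, ExteriorAlgebra.ι_sq_zero, TensorProduct.tmul_zero]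

theorem xCl_mul_swap (i j : Fin n) : xCl p n i * xCl p n j + xCl p n j * xCl p n i = 0 := by
  simp only [xCl, Algebra.TensorProduct.tmul_mul_tmul]
  rw [← TensorProduct.tmul_add, ExteriorAlgebra.ι_add_mul_swap, TensorProduct.tmul_zero]

/-- The linear form in the `x_i` with the given coefficients. -/
def xForm : (Fin n → PolyPart p n) →ₗ[PolyPart p n] Coh p n :=
  Fintype.linearCombination (PolyPart p n) (xCl p n)

theorem xForm_apply (v : Fin n → PolyPart p n) : xForm p n v = ∑ i, v i • xCl p n i :=
  Fintype.linearCombination_apply _ _ _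

theorem xForm_single (i : Fin n) : xForm p n (Pi.single i 1) = xCl p n i := by
  rw [xForm, Fintype.linearCombination_apply_single, one_smul]

theorem xForm_mul_self (v : Fin n → PolyPart p n) : xForm p n v * xForm p n v = 0 := by
  rw [xForm_apply]
  have h : ∀ s : Finset (Fin n),
      (∑ i ∈ s, v i • xCl p n i) * (∑ i ∈ s, v i • xCl p n i) = 0 := by
    intro s
    induction s using Finset.induction_on with
    | empty => simp
    | insert a s ha ih =>
      rw [sum_insert ha, mul_add, add_mul, add_mul, ih, add_zero, smul_mul_smul_comm, xCl_mul_self,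
        smul_zero, zero_add, mul_sum, sum_mul, ← sum_add_distrib]
      refine sum_eq_zero fun i _ => ?_
      rw [smul_mul_smul_comm, smul_mul_smul_comm, mul_comm (v i), ← smul_add, xCl_mul_swap, smul_zero]
  exact h univ

/-- The linear map with `x_i ↦ ∑ t, A i t • x_t`. -/
def substLin (A : Matrix (Fin n) (Fin n) (PolyPart p n)) : (Fin n → ZMod p) →ₗ[ZMod p] Coh p n :=
  Fintype.linearCombination (ZMod p) fun i => xForm p n (A i)

theorem substLin_mul_self (A : Matrix (Fin n) (Fin n) (PolyPart p n)) (v : Fin n → ZMod p) :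
    substLin p n A v * substLin p n A v = 0 := by
  have h : substLin p n A v = xForm p n (∑ i, algebraMap (ZMod p) (PolyPart p n) (v i) • A i) := by
    rw [substLin, Fintype.linearCombination_apply, map_sum]
    refine sum_congr rfl fun i _ => ?_
    rw [map_smul, algebraMap_smul]
  rw [h, xForm_mul_self]

theorem commute_ofId (f : PolyPart p n) (z : Coh p n) :
    Commute (Algebra.ofId (PolyPart p n) (Coh p n) f) z :=
  Algebra.commutes f z

/-- The substitution `x_i ↦ ∑ t, A i t • x_t`, linear over `F_p[y]`. -/
def substX (A : Matrix (Fin n) (Fin n) (PolyPart p n)) : Coh p n →ₐ[PolyPart p n] Coh p n :=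
  Algebra.TensorProduct.lift (Algebra.ofId (PolyPart p n) (Coh p n))
    (ExteriorAlgebra.lift (ZMod p) ⟨substLin p n A, substLin_mul_self p n A⟩)
    fun f _ => commute_ofId p n f _

theorem substX_xCl (A : Matrix (Fin n) (Fin n) (PolyPart p n)) (i : Fin n) :
    substX p n A (xCl p n i) = xForm p n (A i) := by
  rw [substX, xCl, Algebra.TensorProduct.lift_tmul, map_one, one_mul, ExteriorAlgebra.lift_ι_apply,
    substLin, Fintype.linearCombination_apply_single, one_smul]

theorem coh_algHom_ext {φ ψ : Coh p n →ₐ[PolyPart p n] Coh p n}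
    (h : ∀ i, φ (xCl p n i) = ψ (xCl p n i)) : φ = ψ := by
  refine Algebra.TensorProduct.ext (Subsingleton.elim _ _) (ExteriorAlgebra.hom_ext ?_)
  refine LinearMap.pi_ext' fun i => LinearMap.ext_ring ?_
  exact h i

theorem coh_algHom_ext' {φ ψ : Coh p n →ₐ[ZMod p] Coh p n} (h : ∀ i, φ (xCl p n i) = ψ (xCl p n i))
    (h' : ∀ f : PolyPart p n, φ (f ⊗ₜ 1) = ψ (f ⊗ₜ 1)) : φ = ψ := by
  refine Algebra.TensorProduct.ext (AlgHom.ext h') (ExteriorAlgebra.hom_ext ?_)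
  refine LinearMap.pi_ext' fun i => LinearMap.ext_ring ?_
  exact h i

theorem substX_xForm (A : Matrix (Fin n) (Fin n) (PolyPart p n)) (v : Fin n → PolyPart p n) :
    substX p n A (xForm p n v) = xForm p n (Matrix.vecMul v A) := by
  rw [xForm_apply, map_sum]
  simp only [map_smul, substX_xCl]
  simp only [← map_smul, ← map_sum]
  congr 1
  ext1 t
  simp [Matrix.vecMul, dotProduct]

theorem substX_substX (A B : Matrix (Fin n) (Fin n) (PolyPart p n)) (z : Coh p n) :
    substX p n A (substX p n B z) = substX p n (B * A) z := by
  suffices h : (substX p n A).comp (substX p n B) = substX p n (B * A) from DFunLike.congr_fun h z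
  refine coh_algHom_ext p n fun i => ?_
  rw [AlgHom.comp_apply, substX_xCl, substX_xCl, substX_xForm]
  rfl

theorem list_prod_ofFn_smul {R A : Type*} [CommSemiring R] [Semiring A] [Algebra R A] {m : ℕ}
    (c : Fin m → R) (z : Fin m → A) :
    (List.ofFn fun i => c i • z i).prod = (∏ i, c i) • (List.ofFn z).prod := by
  induction m with
  | zero => simp
  | succ m ih =>
    rw [List.ofFn_succ, List.prod_cons, ih, Fin.prod_univ_succ, smul_mul_smul_comm, List.ofFn_succ,
      List.prod_cons]

theorem substX_diagonal (d : Fin n → PolyPart p n) (J : Finset (Fin n)) :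
    substX p n (Matrix.diagonal d) (cohBasis p n J) = (∏ j ∈ J, d j) • cohBasis p n J := by
  rw [cohBasis_eq_prod, map_list_prod, List.map_ofFn]
  have h : ∀ i, substX p n (Matrix.diagonal d) (xCl p n i) = d i • xCl p n i := by
    intro i
    rw [substX_xCl, ← xForm_single, ← map_smul]
    congr 1
    ext1 t
    simp only [Matrix.diagonal_apply, Pi.smul_apply, Pi.single_apply, smul_eq_mul, mul_ite, mul_one,
      mul_zero, eq_comm]
  simp only [Function.comp_def, h]
  refine (list_prod_ofFn_smul (fun c => d (J.orderEmbOfFin rfl c))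
    fun c => xCl p n (J.orderEmbOfFin rfl c)).trans ?_
  congr 1
  conv_rhs => rw [← Finset.map_orderEmbOfFin_univ J rfl, prod_map]
  rfl

/-- A product of k linear forms comes from the k-th exterior power, which has no coordinates at sets
of another size. -/
theorem repr_xForm_prod (k : ℕ) (w : Fin k → Fin n → PolyPart p n) (T : Finset (Fin n))
    (hT : T.card ≠ k) :
    (cohBasis p n).repr (List.ofFn fun c => xForm p n (w c)).prod T = 0 := by
  let F := (ExteriorAlgebra.lift (PolyPart p n) ⟨xForm p n, xForm_mul_self p n⟩).toLinearMap ∘ₗ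
    Submodule.subtype (⋀[PolyPart p n]^k (Fin n → PolyPart p n))
  have hF : ∀ w : Fin k → Fin n → PolyPart p n, F (exteriorPower.ιMulti (PolyPart p n) k w) =
      (List.ofFn fun c => xForm p n (w c)).prod := fun w => by
    simp [F, ExteriorAlgebra.ιMulti_apply, map_list_prod, List.map_ofFn, Function.comp_def]
  suffices h : (cohBasis p n).coord T ∘ₗ F = 0 by
    rw [← hF]
    exact DFunLike.congr_fun h (exteriorPower.ιMulti (PolyPart p n) k w)
  refine ((Pi.basisFun (PolyPart p n) (Fin n)).exteriorPower k).ext fun U => ?_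
  obtain ⟨U, rfl⟩ := U
  rw [LinearMap.comp_apply, exteriorPower.basis_apply, exteriorPower.ιMulti_family, hF]
  have : (List.ofFn fun c => xForm p n ((⇑(Pi.basisFun (PolyPart p n) (Fin n)) ∘
      ⇑(Set.powersetCard.ofFinEmbEquiv.symm (⟨U, rfl⟩ : Set.powersetCard (Fin n) U.card))) c)).prod =
      cohBasis p n U := by
    rw [cohBasis_eq_prod]
    simp only [Function.comp_apply, Pi.basisFun_apply, xForm_single]
    rfl
  rw [this, Module.Basis.coord_apply, Module.Basis.repr_self, Finsupp.single_apply, if_neg]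
  · rfl
  · rintro rfl
    exact hT rfl

theorem repr_substX_of_card_ne (A : Matrix (Fin n) (Fin n) (PolyPart p n)) (J T : Finset (Fin n))
    (h : T.card ≠ J.card) : (cohBasis p n).repr (substX p n A (cohBasis p n J)) T = 0 := by
  rw [cohBasis_eq_prod, map_list_prod, List.map_ofFn]
  simp only [Function.comp_def, substX_xCl]
  exact repr_xForm_prod p n _ _ T h

theorem repr_xForm_singleton (v : Fin n → PolyPart p n) (t : Fin n) :
    (cohBasis p n).repr (xForm p n v) {t} = v t := by
  rw [xForm_apply, map_sum, Finsupp.finsetSum_apply]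
  simp [← cohBasis_singleton, Finsupp.single_apply]

end Substitution

/-! ### The action in the coordinates twisted by Frobenius powers -/

section Action

open Finset

variable (p n : ℕ)

/-- The action on the coefficients in `F_p[y]` only. -/
def coeffAct (g : GL (Fin n) (ZMod p)) : Coh p n →ₐ[ZMod p] Coh p n :=
  Algebra.TensorProduct.map (actPoly p n g) (AlgHom.id (ZMod p) (ExtPart p n))

theorem coeffAct_smul (g : GL (Fin n) (ZMod p)) (f : PolyPart p n) (z : Coh p n) :
    coeffAct p n g (f • z) = actPoly p n g f • coeffAct p n g z := by
  induction z using TensorProduct.induction_on with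
  | zero => simp
  | tmul a b =>
    rw [TensorProduct.smul_tmul', coeffAct, Algebra.TensorProduct.map_tmul,
      Algebra.TensorProduct.map_tmul, TensorProduct.smul_tmul', smul_eq_mul, map_mul, smul_eq_mul]
  | add a b ha hb => rw [smul_add, map_add, map_add, smul_add, ha, hb]

theorem coeffAct_cohBasis (g : GL (Fin n) (ZMod p)) (J : Finset (Fin n)) :
    coeffAct p n g (cohBasis p n J) = cohBasis p n J := by
  rw [cohBasis_eq_tmul, coeffAct, Algebra.TensorProduct.map_tmul, map_one]
  rfl

theorem repr_coeffAct (g : GL (Fin n) (ZMod p)) (z : Coh p n) (T : Finset (Fin n)) :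
    (cohBasis p n).repr (coeffAct p n g z) T = actPoly p n g ((cohBasis p n).repr z T) := by
  conv_lhs => rw [← (cohBasis p n).sum_repr z, map_sum]
  simp only [coeffAct_smul, coeffAct_cohBasis]
  rw [map_sum, Finsupp.finsetSum_apply]
  simp only [map_smul, Module.Basis.repr_self, Finsupp.smul_apply, Finsupp.single_apply, smul_eq_mul,
    mul_ite, mul_one, mul_zero, sum_ite_eq', mem_univ, if_true]

theorem coeffAct_xForm (g : GL (Fin n) (ZMod p)) (v : Fin n → PolyPart p n) :
    coeffAct p n g (xForm p n v) = xForm p n fun t => actPoly p n g (v t) := by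
  rw [xForm_apply, xForm_apply, map_sum]
  refine sum_congr rfl fun i _ => ?_
  rw [coeffAct_smul, ← cohBasis_singleton, coeffAct_cohBasis]

theorem actCoh_xCl (g : GL (Fin n) (ZMod p)) (k : Fin n) :
    actCoh p n g (xCl p n k) = xForm p n fun i => MvPolynomial.C (g.val i k) := by
  rw [actCoh, xCl, Algebra.TensorProduct.map_tmul, map_one, actExt, ExteriorAlgebra.map_apply_ι,
    xForm_apply, Matrix.mulVecLin_apply, Matrix.mulVec_single_one, pi_eq_sum_univ' (g.val.col k),
    map_sum, TensorProduct.tmul_sum]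
  refine sum_congr rfl fun i _ => ?_
  rw [map_smul, TensorProduct.tmul_smul]
  rw [← MvPolynomial.algebraMap_eq, algebraMap_smul, xCl]
  congr 3

theorem repr_substX_diagonal (d : Fin n → PolyPart p n) (z : Coh p n) (T : Finset (Fin n)) :
    (cohBasis p n).repr (substX p n (Matrix.diagonal d) z) T =
      (∏ j ∈ T, d j) * (cohBasis p n).repr z T := by
  conv_lhs => rw [← (cohBasis p n).sum_repr z, map_sum]
  simp only [map_smul, substX_diagonal]
  rw [map_sum, Finsupp.finsetSum_apply]
  simp only [map_smul, Module.Basis.repr_self, Finsupp.smul_apply, Finsupp.single_apply, smul_eq_mul,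
    mul_ite, mul_one, mul_zero, sum_ite_eq', mem_univ, if_true]
  ring

/-- Following the substitution by that of the adjugate scales every x_i by det A, so the coordinate
at T is multiplied by a power of det A. -/
theorem substX_injective [Fact p.Prime] (A : Matrix (Fin n) (Fin n) (PolyPart p n))
    (hA : A.det ≠ 0) : Function.Injective (substX p n A) := by
  rw [injective_iff_map_eq_zero]
  intro z hz
  have h : substX p n (Matrix.diagonal fun _ => A.det) z = 0 := by
    have := substX_substX p n A.adjugate A z
    rw [hz, map_zero, Matrix.mul_adjugate, Matrix.smul_one_eq_diagonal] at this
    exact this.symm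
  refine (cohBasis p n).ext_elem fun T => ?_
  have := repr_substX_diagonal p n (fun _ => A.det) z T
  rw [h, map_zero, Finsupp.zero_apply, prod_const, eq_comm, mul_eq_zero] at this
  rw [map_zero, Finsupp.zero_apply]
  exact this.resolve_left (pow_ne_zero _ hA)

/-- The matrix of the `y_i ^ p ^ t`. -/
def frobMatrix : Matrix (Fin n) (Fin n) (PolyPart p n) :=
  Matrix.of fun i t => MvPolynomial.X i ^ p ^ (t : ℕ)

theorem actPoly_frobMatrix [Fact p.Prime] (g : GL (Fin n) (ZMod p)) (k t : Fin n) :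
    actPoly p n g (frobMatrix p n k t) = ∑ i, MvPolynomial.C (g.val i k) * frobMatrix p n i t := by
  have e1 : actPoly p n g (MvPolynomial.X k) =
      ∑ i, MvPolynomial.C (g.val i k) * MvPolynomial.X i := MvPolynomial.aeval_X _ _
  rw [frobMatrix, Matrix.of_apply, map_pow, e1, sum_C_mul_X_pow]
  rfl

/-- For each t the entries y_k^{p^t} transform under g as the x_k do, because Frobenius fixes F_p.
The new odd variables x_t are therefore invariant. -/
theorem substX_frobMatrix_actCoh [Fact p.Prime] (g : GL (Fin n) (ZMod p)) (z : Coh p n) :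
    substX p n (frobMatrix p n) (actCoh p n g z) = coeffAct p n g (substX p n (frobMatrix p n) z) := by
  suffices h : ((substX p n (frobMatrix p n)).restrictScalars (ZMod p)).comp (actCoh p n g) =
      (coeffAct p n g).comp ((substX p n (frobMatrix p n)).restrictScalars (ZMod p)) from
    DFunLike.congr_fun h z
  refine coh_algHom_ext' p n (fun k => ?_) fun f => ?_
  · change substX p n (frobMatrix p n) (actCoh p n g (xCl p n k)) =
      coeffAct p n g (substX p n (frobMatrix p n) (xCl p n k))
    rw [actCoh_xCl, substX_xForm, substX_xCl, coeffAct_xForm]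
    congr 1
    ext1 t
    rw [actPoly_frobMatrix]
    rfl
  · change substX p n (frobMatrix p n) (actCoh p n g (f ⊗ₜ 1)) =
      coeffAct p n g (substX p n (frobMatrix p n) (f ⊗ₜ 1))
    have h : ∀ f : PolyPart p n, f ⊗ₜ 1 = algebraMap (PolyPart p n) (Coh p n) f := fun _ => rfl
    rw [actCoh, Algebra.TensorProduct.map_tmul, map_one, h, h, AlgHom.commutes, AlgHom.commutes, ← h,
      ← h, coeffAct, Algebra.TensorProduct.map_tmul, map_one]

/-- Multiply by the unitriangular matrix U of coefficients of the V_j. The product has entries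
V_j(y_i), which vanish when y_i is among the variables spanning the roots of V_j, and has the h_j on
its diagonal. -/
theorem det_frobMatrix [Fact p.Prime] : (frobMatrix p n).det = lPoly p n := by
  let V := fun j : Fin n => moorePoly p (hSeq p n) j
  let U : Matrix (Fin n) (Fin n) (PolyPart p n) := Matrix.of fun t j =>
    if (t : ℕ) ≤ j then (-1) ^ ((j : ℕ) - t) * dicksonSum p (hSeq p n) j (j - t) else 0
  have hU : U.det = 1 := by
    rw [Matrix.det_of_isUpperTriangular]
    · refine prod_eq_one fun i _ => ?_
      simp [U]
    · intro i j hij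
      simp only [U, Matrix.of_apply]
      rw [if_neg]
      exact not_le.2 hij
  have hYU : ∀ i j, (frobMatrix p n * U) i j = (V j).eval (MvPolynomial.X i) := by
    intro i j
    simp only [V]
    rw [moorePoly_eq_sum, Matrix.mul_apply, Polynomial.eval_finsetSum, ← sum_range_reflect]
    have h1 : ∑ t, frobMatrix p n i t * U t j = ∑ t ∈ range n, if t ≤ (j : ℕ) then
        MvPolynomial.X i ^ p ^ t * ((-1) ^ ((j : ℕ) - t) * dicksonSum p (hSeq p n) j (j - t))
        else 0 := by
      rw [sum_range]
      refine sum_congr rfl fun t _ => ?_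
      simp only [U, frobMatrix, Matrix.of_apply, mul_ite, mul_zero]
    rw [h1, ← sum_filter]
    have h2 : (range n).filter (· ≤ (j : ℕ)) = range (j + 1) := by
      ext t
      simp only [mem_filter, mem_range]
      have := j.2
      omega
    rw [h2]
    refine sum_congr rfl fun t ht => ?_
    have ht := mem_range.1 ht
    simp only [Polynomial.eval_mul, Polynomial.eval_C, Polynomial.eval_pow, Polynomial.eval_X]
    rw [show (j : ℕ) + 1 - 1 - t = j - t by omega, show (j : ℕ) - (j - t) = t by omega, mul_comm]
  have hdet : (frobMatrix p n * U).det = lPoly p n := by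
    rw [Matrix.det_of_isLowerTriangular]
    · refine prod_congr rfl fun j _ => ?_
      rw [hYU, hPoly_eq_eval, spanPoly_X_eq p n j j.2.le]
    · intro i j hij
      have hij : i < j := hij
      rw [hYU]
      simp only [V]
      rw [← spanPoly_X_eq p n j j.2.le, spanPoly, Polynomial.eval_prod]
      refine prod_eq_zero (i := Pi.single i 1) ?_ ?_
      · simp only [mem_filter, mem_univ, true_and]
        intro k hk
        rw [Pi.single_apply, if_neg]
        rintro rfl
        exact absurd hk (not_le.2 hij)
      · simp [Pi.single_apply, ite_mul]
  rw [← hdet, Matrix.det_mul, hU, mul_one]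

theorem lPoly_ne_zero [Fact p.Prime] : lPoly p n ≠ 0 :=
  prod_ne_zero_iff.2 fun j _ => hPoly_ne_zero p n j

theorem actPoly_lPoly [Fact p.Prime] (g : GL (Fin n) (ZMod p)) :
    actPoly p n g (lPoly p n) = MvPolynomial.C g.val.det * lPoly p n := by
  rw [← det_frobMatrix, AlgHom.map_det]
  have : (actPoly p n g).mapMatrix (frobMatrix p n) =
      (g.val.transpose.map MvPolynomial.C) * frobMatrix p n := by
    ext1 k t
    rw [AlgHom.mapMatrix_apply, Matrix.map_apply, actPoly_frobMatrix]
    rfl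
  rw [this, Matrix.det_mul, ← Matrix.det_transpose g.val, RingHom.map_det]
  rfl

theorem actPoly_lPoly_pow [Fact p.Prime] (g : GL (Fin n) (ZMod p)) :
    actPoly p n g (lPoly p n ^ (p - 1)) = lPoly p n ^ (p - 1) := by
  rw [map_pow, actPoly_lPoly, mul_pow, ← map_pow, ZMod.pow_card_sub_one_eq_one, map_one, one_mul]
  exact ((Matrix.isUnit_iff_isUnit_det _).1 g.isUnit).ne_zero

theorem map_muiDet {A B : Type*} [Ring A] [Ring B] (φ : A →+* B) {m : ℕ} (x y : Fin m → A)
    (S : Finset ℕ) :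
    φ (muiDet p x y S) = muiDet p (fun i => φ (x i)) (fun i => φ (y i)) S := by
  simp only [muiDet, map_sum, map_zsmul, map_list_prod, List.map_ofFn, Function.comp_def, apply_ite φ,
    map_pow]

theorem substX_muiM [Fact p.Prime] (J : Finset (Fin n)) :
    ∃ ε : ℤˣ, substX p n (frobMatrix p n) (muiM p n n le_rfl (J.map Fin.valEmbedding)) =
      (ε : ℤ) • lPoly p n • cohBasis p n J := by
  obtain ⟨ε, hε⟩ := muiDet_eq p J (xForm p n) (xForm_mul_self p n) (frobMatrix p n) (yCl p n)
    (fun i t => by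
      rw [yCl, Algebra.TensorProduct.tmul_pow, one_pow]
      rfl)
  refine ⟨ε, ?_⟩
  have h := map_muiDet p (substX p n (frobMatrix p n) : Coh p n →+* Coh p n)
    (fun i : Fin n => xCl p n i) (fun i : Fin n => yCl p n i) (J.map Fin.valEmbedding)
  have hy : ∀ i, substX p n (frobMatrix p n) (yCl p n i) = yCl p n i := fun i =>
    AlgHom.commutes (substX p n (frobMatrix p n)) (MvPolynomial.X i)
  simp only [RingHom.coe_coe, substX_xCl, hy] at h
  rw [hε] at h
  rw [det_frobMatrix] at h
  simp only [xForm_single] at h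
  rw [← cohBasis_eq_prod] at h
  exact h

end Action

/-! ### Divisibility of the coordinates of an invariant -/

section Divisibility

open Finset

variable (p n : ℕ)

theorem actCoh_eq_substX (g : GL (Fin n) (ZMod p)) (z : Coh p n) :
    actCoh p n g z = substX p n (g.val.transpose.map MvPolynomial.C) (coeffAct p n g z) := by
  suffices h : actCoh p n g =
      ((substX p n (g.val.transpose.map MvPolynomial.C)).restrictScalars (ZMod p)).comp
        (coeffAct p n g) from DFunLike.congr_fun h z
  refine coh_algHom_ext' p n (fun k => ?_) fun f => ?_
  · change _ = substX p n (g.val.transpose.map MvPolynomial.C) (coeffAct p n g (xCl p n k))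
    rw [actCoh_xCl, ← cohBasis_singleton, coeffAct_cohBasis, cohBasis_singleton, substX_xCl]
    rfl
  · change _ = substX p n (g.val.transpose.map MvPolynomial.C) (coeffAct p n g (f ⊗ₜ 1))
    have h : ∀ f : PolyPart p n, f ⊗ₜ 1 = algebraMap (PolyPart p n) (Coh p n) f := fun _ => rfl
    rw [coeffAct, Algebra.TensorProduct.map_tmul, map_one, h (actPoly p n g f),
      AlgHom.commutes, ← h, actCoh, Algebra.TensorProduct.map_tmul, map_one]

theorem cohBasis_mul_of_disjoint {J K : Finset (Fin n)} (h : Disjoint J K) :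
    ∃ ε : ℤˣ, cohBasis p n J * cohBasis p n K = (ε : ℤ) • cohBasis p n (J ∪ K) := by
  have := ExteriorAlgebra.basis_mul_of_disjoint (Pi.basisFun (ZMod p) (Fin n))
    (⟨J, rfl⟩ : Set.powersetCard (Fin n) J.card) (⟨K, rfl⟩ : Set.powersetCard (Fin n) K.card) h
  refine ⟨Equiv.Perm.sign (Set.powersetCard.permOfDisjoint
    (s := (⟨J, rfl⟩ : Set.powersetCard (Fin n) J.card))
    (t := (⟨K, rfl⟩ : Set.powersetCard (Fin n) K.card)) h), ?_⟩
  rw [cohBasis_eq_tmul, cohBasis_eq_tmul, cohBasis_eq_tmul, Algebra.TensorProduct.tmul_mul_tmul,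
    one_mul, ← TensorProduct.tmul_smul]
  congr 1
  refine this.trans ?_
  rw [Units.smul_def]
  congr 2
  exact Finset.disjUnion_eq_union J K h

theorem xCl_mul_cohBasis_of_mem {b : Fin n} {K : Finset (Fin n)} (h : b ∈ K) :
    xCl p n b * cohBasis p n K = 0 := by
  obtain ⟨ε, hε⟩ := cohBasis_mul_of_disjoint p n (J := {b}) (K := K.erase b) (by simp)
  rw [cohBasis_singleton, ← insert_eq, insert_erase h] at hε
  have h2 : cohBasis p n K = (ε : ℤ) • (xCl p n b * cohBasis p n (K.erase b)) := by
    rw [hε, smul_smul, ← Units.val_mul, Int.units_mul_self, Units.val_one, one_smul]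
  rw [h2, mul_smul_comm, ← mul_assoc, xCl_mul_self, zero_mul, smul_zero]

theorem substX_cohBasis_of_fixed (A : Matrix (Fin n) (Fin n) (PolyPart p n)) (K : Finset (Fin n))
    (h : ∀ k ∈ K, substX p n A (xCl p n k) = xCl p n k) :
    substX p n A (cohBasis p n K) = cohBasis p n K := by
  rw [cohBasis_eq_prod, map_list_prod, List.map_ofFn]
  congr 2
  funext c
  exact h _ (orderEmbOfFin_mem K rfl c)

theorem substX_cohBasis_of_add {A : Matrix (Fin n) (Fin n) (PolyPart p n)} {a b : Fin n}
    (hA : ∀ k ≠ a, substX p n A (xCl p n k) = xCl p n k)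
    (ha : substX p n A (xCl p n a) = xCl p n a + xCl p n b) (U : Finset (Fin n)) :
    ∃ ε : ℤ, substX p n A (cohBasis p n U) =
        cohBasis p n U + ε • cohBasis p n (insert b (U.erase a)) ∧
      (a ∉ U ∨ b ∈ U.erase a → ε = 0) ∧ (a ∈ U → b ∉ U.erase a → IsUnit ε) := by
  by_cases haU : a ∈ U
  · obtain ⟨δ, hδ⟩ := cohBasis_mul_of_disjoint p n (J := {a}) (K := U.erase a) (by simp)
    rw [cohBasis_singleton, ← insert_eq, insert_erase haU] at hδ
    have h2 : cohBasis p n U = (δ : ℤ) • (xCl p n a * cohBasis p n (U.erase a)) := by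
      rw [hδ, smul_smul, ← Units.val_mul, Int.units_mul_self, Units.val_one, one_smul]
    have h3 : substX p n A (cohBasis p n U) =
        cohBasis p n U + (δ : ℤ) • (xCl p n b * cohBasis p n (U.erase a)) := by
      rw [h2, map_zsmul, map_mul, ha, substX_cohBasis_of_fixed p n A (U.erase a)
        (fun k hk => hA k (ne_of_mem_erase hk)), add_mul, smul_add]
    by_cases hb : b ∈ U.erase a
    · refine ⟨0, ?_, fun _ => rfl, fun _ h => absurd hb h⟩
      rw [h3, xCl_mul_cohBasis_of_mem p n hb, smul_zero, zero_smul]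
    · obtain ⟨η, hη⟩ := cohBasis_mul_of_disjoint p n (J := {b}) (K := U.erase a) (by simpa using hb)
      rw [cohBasis_singleton, ← insert_eq] at hη
      refine ⟨(δ * η : ℤˣ), ?_, ?_, fun _ _ => Units.isUnit _⟩
      · rw [h3, hη, smul_smul, Units.val_mul]
      · rintro (h | h)
        · exact absurd haU h
        · exact absurd h hb
  · refine ⟨0, ?_, fun _ => rfl, fun h => absurd h haU⟩
    rw [zero_smul, add_zero]
    exact substX_cohBasis_of_fixed p n A U fun k hk => hA k (by rintro rfl; exact haU hk)

/-- Only x_J and the target monomial itself contribute to the coordinate where a has been exchanged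
for b; the exchange determines J. -/
theorem repr_substX_of_add {A : Matrix (Fin n) (Fin n) (PolyPart p n)} {a b : Fin n}
    (hA : ∀ k ≠ a, substX p n A (xCl p n k) = xCl p n k)
    (ha : substX p n A (xCl p n a) = xCl p n a + xCl p n b) {J : Finset (Fin n)} (haJ : a ∈ J)
    (hbJ : b ∉ J) :
    ∃ ε : ℤ, IsUnit ε ∧ ∀ z, (cohBasis p n).repr (substX p n A z) (insert b (J.erase a)) =
      (cohBasis p n).repr z (insert b (J.erase a)) + ε • (cohBasis p n).repr z J := by
  choose ε hε hε0 hε1 using substX_cohBasis_of_add p n hA ha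
  refine ⟨ε J, hε1 J haJ fun h => hbJ (mem_of_mem_erase h), fun z => ?_⟩
  suffices h : (cohBasis p n).coord (insert b (J.erase a)) ∘ₗ (substX p n A).toLinearMap =
      (cohBasis p n).coord (insert b (J.erase a)) + ε J • (cohBasis p n).coord J from
    DFunLike.congr_fun h z
  refine (cohBasis p n).ext fun U => ?_
  have hJ' : J.erase a = (insert b (J.erase a)).erase b := by
    rw [erase_insert]
    exact fun h => hbJ (mem_of_mem_erase h)
  simp only [LinearMap.comp_apply, AlgHom.toLinearMap_apply, hε, map_add, map_zsmul,
    LinearMap.add_apply, LinearMap.smul_apply, Module.Basis.coord_apply, Module.Basis.repr_self]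
  congr 1
  by_cases hU : a ∉ U ∨ b ∈ U.erase a
  · rw [hε0 U hU, zero_smul, Finsupp.single_apply, if_neg, smul_zero]
    rintro rfl
    rcases hU with h | h
    · exact h haJ
    · exact hbJ (mem_of_mem_erase h)
  · push Not at hU
    by_cases hUJ : U = J
    · subst hUJ
      simp
    · rw [Finsupp.single_apply, Finsupp.single_apply, if_neg hUJ, if_neg, smul_zero, smul_zero]
      intro h
      apply hUJ
      have h2 : U.erase a = J.erase a := by
        rw [hJ', ← h, erase_insert hU.2]
      rw [← insert_erase hU.1, h2, insert_erase haJ]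

/-! ### Transvections and diagonal matrices in the parabolic subgroup -/

variable [Fact p.Prime]

theorem X_dvd_sub_actPoly {g : GL (Fin n) (ZMod p)} {b : Fin n}
    (h : ∀ k, (MvPolynomial.X b : PolyPart p n) ∣
      MvPolynomial.X k - actPoly p n g (MvPolynomial.X k)) (f : PolyPart p n) :
    (MvPolynomial.X b : PolyPart p n) ∣ f - actPoly p n g f := by
  have h2 : (Ideal.Quotient.mkₐ (ZMod p) (Ideal.span {(MvPolynomial.X b : PolyPart p n)})) =
      (Ideal.Quotient.mkₐ (ZMod p) (Ideal.span {(MvPolynomial.X b : PolyPart p n)})).comp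
        (actPoly p n g) := by
    refine MvPolynomial.algHom_ext fun k => ?_
    rw [AlgHom.comp_apply, Ideal.Quotient.mkₐ_eq_mk, Ideal.Quotient.eq,
      Ideal.mem_span_singleton]
    exact h k
  have := DFunLike.congr_fun h2 f
  rwa [AlgHom.comp_apply, Ideal.Quotient.mkₐ_eq_mk, Ideal.Quotient.eq,
    Ideal.mem_span_singleton] at this

/-- The element of `GL(n, F_p)` with `y_a ↦ y_a + y_b` that fixes the other `y_k`. -/
def transvectionGL {a b : Fin n} (hab : a ≠ b) : GL (Fin n) (ZMod p) :=
  Matrix.GeneralLinearGroup.mkOfDetNeZero (Matrix.transvection b a 1)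
    (by rw [Matrix.det_transvection_of_ne _ _ hab.symm]; exact one_ne_zero)

theorem transvectionGL_apply {a b : Fin n} (hab : a ≠ b) (i k : Fin n) :
    (transvectionGL p n hab).val i k = (if i = k then 1 else 0) + if b = i ∧ a = k then 1 else 0 := by
  change Matrix.transvection b a (1 : ZMod p) i k = _
  rw [Matrix.transvection, Matrix.add_apply, Matrix.one_apply, Matrix.single_apply]

theorem transvectionGL_mem {a b : Fin n} (hab : a ≠ b) (ha : (a : ℕ) ≠ 0) :
    transvectionGL p n hab ∈ parabolic p n 1 := by
  rw [mem_parabolic]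
  intro i j hi hj
  rw [transvectionGL_apply, if_neg, if_neg, add_zero]
  · rintro ⟨-, rfl⟩
    omega
  · rintro rfl
    omega

/-- Apply the transvection y_a ↦ y_a + y_b, which lies in the parabolic because a is not the first
index. Invariance at the exchanged set expresses the coordinate at J, up to sign and the action, as
a difference q - gq, and g is the identity modulo y_b. -/
theorem X_dvd_repr_of_mem_cohInvariants {f : Coh p n}
    (hf : f ∈ cohInvariants p n (parabolic p n 1)) {a b : Fin n} (ha : (a : ℕ) ≠ 0)
    {J : Finset (Fin n)} (haJ : a ∈ J) (hbJ : b ∉ J) :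
    (MvPolynomial.X b : PolyPart p n) ∣ (cohBasis p n).repr f J := by
  have hab : a ≠ b := by rintro rfl; exact hbJ haJ
  set g := transvectionGL p n hab with hg
  have hgf : actCoh p n g f = f := (mem_cohInvariants p n _ f).1 hf g (transvectionGL_mem p n hab ha)
  rw [actCoh_eq_substX] at hgf
  have hrow : ∀ k, substX p n (g.val.transpose.map MvPolynomial.C) (xCl p n k) =
      xCl p n k + if a = k then xCl p n b else 0 := by
    intro k
    rw [substX_xCl, xForm_apply]
    simp only [Matrix.map_apply, Matrix.transpose_apply, hg, transvectionGL_apply, map_add, add_smul,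
      sum_add_distrib, apply_ite MvPolynomial.C, map_one, map_zero, ite_smul, one_smul, zero_smul,
      sum_ite_eq', mem_univ, if_true]
    congr 1
    by_cases h : a = k <;> simp [h]
  obtain ⟨ε, hε, hz⟩ := repr_substX_of_add p n (A := g.val.transpose.map MvPolynomial.C)
    (fun k hk => by rw [hrow, if_neg (Ne.symm hk), add_zero]) (by rw [hrow, if_pos rfl]) haJ hbJ
  have h1 := hz (coeffAct p n g f)
  rw [hgf, repr_coeffAct, repr_coeffAct] at h1
  have hX : ∀ k, (MvPolynomial.X b : PolyPart p n) ∣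
      MvPolynomial.X k - actPoly p n g (MvPolynomial.X k) := by
    intro k
    have : actPoly p n g (MvPolynomial.X k) =
        MvPolynomial.X k + if a = k then MvPolynomial.X b else 0 := by
      rw [actPoly, MvPolynomial.aeval_X]
      simp only [hg, transvectionGL_apply, map_add, add_mul,
        sum_add_distrib, apply_ite MvPolynomial.C, map_one, map_zero, ite_mul, one_mul, zero_mul,
        sum_ite_eq', mem_univ, if_true]
      congr 1
      by_cases h : a = k <;> simp [h]
    rw [this]
    split_ifs <;> simp
  have h2 := X_dvd_sub_actPoly p n hX ((cohBasis p n).repr f (insert b (J.erase a)))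
  have h3 := X_dvd_sub_actPoly p n hX ((cohBasis p n).repr f J)
  -- After this, the difference divisible by y_b is ± the image under g of the coordinate at J.
  rw [sub_eq_iff_eq_add'.2 h1] at h2
  have h4 : (MvPolynomial.X b : PolyPart p n) ∣ actPoly p n g ((cohBasis p n).repr f J) := by
    rcases Int.isUnit_iff.1 hε with rfl | rfl
    · simpa using h2
    · simpa using h2
  simpa using dvd_add h3 h4

/-- The element of `GL(n, F_p)` with `y_b ↦ ζ y_b` that fixes the other `y_k`. -/
def torusGL (b : Fin n) (ζ : (ZMod p)ˣ) : GL (Fin n) (ZMod p) :=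
  Matrix.GeneralLinearGroup.mkOfDetNeZero
    (Matrix.diagonal (Function.update (fun _ => (1 : ZMod p)) b (ζ : ZMod p)))
    (by
      rw [Matrix.det_diagonal, prod_update_of_mem (mem_univ b)]
      simp)

theorem torusGL_mem (b : Fin n) (ζ : (ZMod p)ˣ) : torusGL p n b ζ ∈ parabolic p n 1 := by
  rw [mem_parabolic]
  intro i j hi hj
  change Matrix.diagonal _ i j = 0
  rw [Matrix.diagonal_apply_ne]
  rintro rfl
  omega

theorem coeff_actPoly_torusGL (b : Fin n) (ζ : (ZMod p)ˣ) (f : PolyPart p n) (m : Fin n →₀ ℕ) :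
    (actPoly p n (torusGL p n b ζ) f).coeff m = (ζ : ZMod p) ^ m b * f.coeff m := by
  have hX : ∀ k, actPoly p n (torusGL p n b ζ) (MvPolynomial.X k) =
      MvPolynomial.C (Function.update (fun _ => (1 : ZMod p)) b (ζ : ZMod p) k) * MvPolynomial.X k := by
    intro k
    rw [actPoly, MvPolynomial.aeval_X, sum_eq_single k]
    · congr 2
      exact Matrix.diagonal_apply_eq _ _
    · intro i _ hik
      have : (torusGL p n b ζ).val i k = 0 := Matrix.diagonal_apply_ne _ hik
      rw [this, map_zero, zero_mul]
    · simp
  induction f using MvPolynomial.induction_on' with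
  | monomial u c =>
    have : actPoly p n (torusGL p n b ζ) (MvPolynomial.monomial u c) =
        MvPolynomial.monomial u ((ζ : ZMod p) ^ u b * c) := by
      rw [MvPolynomial.monomial_eq, Finsupp.prod_fintype _ _ (fun _ => pow_zero _), map_mul, map_prod]
      simp only [map_pow, hX, mul_pow, prod_mul_distrib]
      rw [MvPolynomial.monomial_eq, Finsupp.prod_fintype _ _ (fun _ => pow_zero _), map_mul,
        ← mul_assoc]
      congr 1
      rw [actPoly, MvPolynomial.algHom_C, MvPolynomial.algebraMap_eq, mul_comm]
      congr 1
      rw [prod_eq_single b]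
      · rw [Function.update_self, map_pow]
      · intro k _ hk
        rw [Function.update_of_ne hk, map_one, one_pow]
      · simp
    rw [this, MvPolynomial.coeff_monomial, MvPolynomial.coeff_monomial]
    split_ifs with h
    · rw [h]
    · rw [mul_zero]
  | add f g hf hg => rw [map_add, MvPolynomial.coeff_add, hf, hg, MvPolynomial.coeff_add, mul_add]

/-- Scaling y_b and x_b by ζ multiplies the monomial y^m x_J by ζ to the displayed exponent, so
invariance makes that power of every unit ζ equal to 1. -/
theorem sub_one_dvd_of_coeff_repr_ne_zero {f : Coh p n}
    (hf : f ∈ cohInvariants p n (parabolic p n 1)) (b : Fin n) (J : Finset (Fin n)) (m : Fin n →₀ ℕ)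
    (hm : ((cohBasis p n).repr f J).coeff m ≠ 0) : p - 1 ∣ m b + if b ∈ J then 1 else 0 := by
  have h := FiniteField.forall_pow_eq_one_iff (K := ZMod p) (m b + if b ∈ J then 1 else 0)
  rw [ZMod.card] at h
  refine h.1 fun ζ => ?_
  have hgf := (mem_cohInvariants p n _ f).1 hf _ (torusGL_mem p n b ζ)
  rw [actCoh_eq_substX] at hgf
  have hd : (torusGL p n b ζ).val.transpose.map MvPolynomial.C = Matrix.diagonal fun k =>
      (MvPolynomial.C (Function.update (fun _ => (1 : ZMod p)) b (ζ : ZMod p) k) : PolyPart p n) := by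
    change (Matrix.diagonal (Function.update (fun _ => (1 : ZMod p)) b (ζ : ZMod p))).transpose.map
      MvPolynomial.C = _
    rw [Matrix.diagonal_transpose, Matrix.diagonal_map (map_zero _)]
  rw [hd] at hgf
  have h1 := congrArg (fun z => ((cohBasis p n).repr z J).coeff m) hgf
  simp only [repr_substX_diagonal, repr_coeffAct] at h1
  have hprod : ∏ k ∈ J,
      (MvPolynomial.C (Function.update (fun _ => (1 : ZMod p)) b (ζ : ZMod p) k) : PolyPart p n) =
      MvPolynomial.C ((ζ : ZMod p) ^ (if b ∈ J then 1 else 0)) := by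
    rw [← map_prod]
    congr 1
    split_ifs with hb
    · rw [prod_update_of_mem hb]
      simp
    · rw [prod_update_of_notMem hb]
      simp
  rw [hprod, MvPolynomial.coeff_C_mul, coeff_actPoly_torusGL, ← mul_assoc, ← pow_add] at h1
  refine Units.ext ?_
  rw [Units.val_pow_eq_pow_val, Units.val_one, add_comm]
  exact mul_right_cancel₀ hm (h1.trans (one_mul _).symm)

theorem X_pow_dvd_of_forall {R : Type*} [CommRing R] {σ : Type*} {f : MvPolynomial σ R} {b : σ}
    {k : ℕ} (h : ∀ m, f.coeff m ≠ 0 → k ≤ m b) : MvPolynomial.X b ^ k ∣ f := by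
  rw [f.as_sum]
  refine dvd_sum fun m hm => ?_
  rw [MvPolynomial.X_pow_eq_monomial]
  exact MvPolynomial.monomial_dvd_monomial.2
    ⟨Or.inr (Finsupp.single_le_iff.2 (h m (MvPolynomial.mem_support_iff.1 hm))), one_dvd _⟩

theorem X_pow_sub_two_dvd_repr {f : Coh p n} (hf : f ∈ cohInvariants p n (parabolic p n 1))
    {b : Fin n} {J : Finset (Fin n)} (hb : b ∈ J) :
    (MvPolynomial.X b : PolyPart p n) ^ (p - 2) ∣ (cohBasis p n).repr f J := by
  refine X_pow_dvd_of_forall fun m hm => ?_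
  have h := sub_one_dvd_of_coeff_repr_ne_zero p n hf b J m hm
  rw [if_pos hb] at h
  have := Nat.le_of_dvd (by omega) h
  omega

/-- For b ∉ J each exponent of y_b is a multiple of p - 1. The transvection argument excludes the
exponent 0, so it is at least p - 1. -/
theorem X_pow_sub_one_dvd_repr {f : Coh p n} (hf : f ∈ cohInvariants p n (parabolic p n 1))
    {a b : Fin n} (ha : (a : ℕ) ≠ 0) {J : Finset (Fin n)} (haJ : a ∈ J) (hbJ : b ∉ J) :
    (MvPolynomial.X b : PolyPart p n) ^ (p - 1) ∣ (cohBasis p n).repr f J := by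
  refine X_pow_dvd_of_forall fun m hm => ?_
  have h := sub_one_dvd_of_coeff_repr_ne_zero p n hf b J m hm
  rw [if_neg hbJ, add_zero] at h
  refine Nat.le_of_dvd (Nat.pos_of_ne_zero fun h0 => hm ?_) h
  obtain ⟨q, hq⟩ := X_dvd_repr_of_mem_cohInvariants p n hf ha haJ hbJ
  rw [hq, MvPolynomial.coeff_X_mul', if_neg]
  simpa using h0

end Divisibility

/-! ### Divisibility by the product of the linear forms -/

section LinearFactors

open Finset

variable (p n : ℕ)

/-- The linear form in the `y_i` with the given coefficients. -/
def linForm (w : Fin n → ZMod p) : PolyPart p n := ∑ k, MvPolynomial.C (w k) * MvPolynomial.X k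

theorem eval_linForm (w u : Fin n → ZMod p) : MvPolynomial.eval u (linForm p n w) = ∑ k, w k * u k := by
  simp [linForm]

theorem linForm_single_sub (j : Fin n) (c : Fin n → ZMod p) :
    linForm p n (Pi.single j 1 - c) =
      MvPolynomial.X j - ∑ k, MvPolynomial.C (c k) * MvPolynomial.X k := by
  simp [linForm, sub_mul, sum_sub_distrib, Pi.single_apply, apply_ite MvPolynomial.C, ite_mul]

theorem coeff_linForm (w : Fin n → ZMod p) (i : Fin n) :
    (linForm p n w).coeff (Finsupp.single i 1) = w i := by
  simp [linForm, MvPolynomial.coeff_sum, MvPolynomial.coeff_C_mul, MvPolynomial.coeff_X,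
    Finsupp.single_left_inj]

variable [Fact p.Prime]

theorem irreducible_linForm {w : Fin n → ZMod p} {i : Fin n} (hw : w i ≠ 0) :
    Irreducible (linForm p n w) := by
  refine MvPolynomial.irreducible_of_totalDegree_eq_one ?_ fun x hx => ?_
  · refine MvPolynomial.IsHomogeneous.totalDegree (MvPolynomial.IsHomogeneous.sum _ _ _ fun k _ => ?_) ?_
    · simpa using (MvPolynomial.isHomogeneous_C (Fin n) (w k)).mul (MvPolynomial.isHomogeneous_X _ k)
    · intro h
      have := coeff_linForm p n w i
      rw [h, MvPolynomial.coeff_zero] at this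
      exact hw this.symm
  · have := hx (Finsupp.single i 1)
    rw [coeff_linForm] at this
    exact isUnit_iff_ne_zero.2 (ne_zero_of_dvd_ne_zero hw this)

theorem isRelPrime_linForm {w w' : Fin n → ZMod p} {i : Fin n} (hw : w i ≠ 0) (u : Fin n → ZMod p)
    (h : ∑ k, w k * u k = 0) (h' : ∑ k, w' k * u k ≠ 0) :
    IsRelPrime (linForm p n w) (linForm p n w') := by
  refine (irreducible_linForm p n hw).isRelPrime_iff_not_dvd.2 fun ⟨q, hq⟩ => h' ?_
  rw [← eval_linForm, hq, map_mul, eval_linForm, h, zero_mul]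

theorem isRelPrime_linForm_of_lt {j j' : Fin n} {c c' : Fin n → ZMod p} (hc : ∀ k, j ≤ k → c k = 0)
    (hc' : ∀ k, j' ≤ k → c' k = 0) (hj : j < j') :
    IsRelPrime (linForm p n (Pi.single j 1 - c)) (linForm p n (Pi.single j' 1 - c')) := by
  refine isRelPrime_linForm p n (i := j) ?_ (Pi.single j' 1) ?_ ?_
  · simp [hc j le_rfl]
  · simp [Pi.single_apply, hj.ne', hc j' hj.le]
  · simp [Pi.single_apply, hc' j' le_rfl]

theorem isRelPrime_linForm_of_ne {j : Fin n} {c c' : Fin n → ZMod p} (hc : ∀ k, j ≤ k → c k = 0)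
    (hc' : ∀ k, j ≤ k → c' k = 0) (h : c ≠ c') :
    IsRelPrime (linForm p n (Pi.single j 1 - c)) (linForm p n (Pi.single j 1 - c')) := by
  obtain ⟨k, hk⟩ := Function.ne_iff.1 h
  have hkj : k ≠ j := by
    rintro rfl
    exact hk ((hc k le_rfl).trans (hc' k le_rfl).symm)
  -- At the point e_k + c_k e_j the first form vanishes, and the second takes the value c_k - c'_k.
  refine isRelPrime_linForm p n (i := j) ?_ (Pi.single k 1 + Pi.single j (c k)) ?_ ?_
  · simp [hc j le_rfl]
  · simp [Pi.single_apply, mul_add, sum_add_distrib, hkj, hc j le_rfl]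
  · simp only [Pi.sub_apply, Pi.add_apply, Pi.single_apply, mul_add, sum_add_distrib, mul_ite, mul_one,
      mul_zero, sum_ite_eq', mem_univ, if_true, hkj, if_false, hc' j le_rfl]
    intro h0
    apply hk
    linear_combination h0

theorem lPoly_pow_eq_prod (m : ℕ) :
    lPoly p n ^ m = ∏ s ∈ (univ : Finset (Fin n)).sigma
      (fun j => {c : Fin n → ZMod p | ∀ k, j ≤ k → c k = 0}),
        linForm p n (Pi.single s.1 1 - s.2) ^ m := by
  rw [prod_pow, prod_sigma, lPoly]
  simp only [hPoly, linForm_single_sub]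

/-- The matrix `1` with its column `k` replaced by `w`. -/
def updateColGL {w : Fin n → ZMod p} {k : Fin n} (hw : w k ≠ 0) : GL (Fin n) (ZMod p) :=
  Matrix.GeneralLinearGroup.mkOfDetNeZero ((1 : Matrix (Fin n) (Fin n) (ZMod p)).updateCol k w)
    (by rwa [← Matrix.cramer_apply, Matrix.cramer_one])

theorem updateColGL_mem {w : Fin n → ZMod p} {k : Fin n} (hw : w k ≠ 0) (hk : (k : ℕ) ≠ 0) :
    updateColGL p n hw ∈ parabolic p n 1 := by
  rw [mem_parabolic]
  intro i j hi hj
  change Matrix.updateCol _ _ _ i j = 0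
  rw [Matrix.updateCol_ne, Matrix.one_apply_ne]
  · rintro rfl
    omega
  · rintro rfl
    omega

theorem actPoly_updateColGL {w : Fin n → ZMod p} {k : Fin n} (hw : w k ≠ 0) :
    actPoly p n (updateColGL p n hw) (MvPolynomial.X k) = linForm p n w := by
  rw [actPoly, MvPolynomial.aeval_X, linForm]
  refine sum_congr rfl fun i _ => ?_
  congr 2
  exact Matrix.updateCol_self

/-- L_n is a product of pairwise coprime linear forms y_j - ∑ c_k y_k. For j not the first index,
some element of the parabolic sends y_j to that form, so its m-th power divides φ together with
y_j^m; for the first index the form is y_1 itself. -/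
theorem lPoly_pow_dvd {φ : PolyPart p n}
    (hφ : φ ∈ polyInvariants p n (parabolic p n 1)) {m : ℕ}
    (h : ∀ b, (MvPolynomial.X b : PolyPart p n) ^ m ∣ φ) : lPoly p n ^ m ∣ φ := by
  rw [lPoly_pow_eq_prod]
  refine prod_dvd_of_isRelPrime ?_ ?_
  · rintro ⟨j, c⟩ hc ⟨j', c'⟩ hc' hne
    simp only [coe_sigma, Set.mem_sigma_iff, mem_coe, mem_univ, true_and, mem_filter] at hc hc'
    change IsRelPrime (_ ^ m) (_ ^ m)
    refine IsRelPrime.pow ?_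
    rcases lt_trichotomy j j' with hj | rfl | hj
    · exact isRelPrime_linForm_of_lt p n hc hc' hj
    · exact isRelPrime_linForm_of_ne p n hc hc' fun h => hne (congrArg (Sigma.mk j) h)
    · exact (isRelPrime_linForm_of_lt p n hc' hc hj).symm
  · rintro ⟨j, c⟩ hc
    simp only [mem_sigma, mem_univ, true_and, mem_filter] at hc
    have hw : (Pi.single j 1 - c : Fin n → ZMod p) j ≠ 0 := by simp [hc j le_rfl]
    by_cases hj : (j : ℕ) = 0
    · have h0 : linForm p n (Pi.single j 1 - c) = MvPolynomial.X j := by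
        rw [linForm_single_sub, sum_eq_zero, sub_zero]
        intro k _
        rw [hc k (Fin.le_def.2 (by omega)), map_zero, zero_mul]
      rw [h0]
      exact h j
    · have := map_dvd (actPoly p n (updateColGL p n hw)) (h j)
      rwa [map_pow, actPoly_updateColGL,
        (mem_polyInvariants p n _ φ).1 hφ _ (updateColGL_mem p n hw hj)] at this

end LinearFactors

/-! ### Divisibility of the twisted coordinates -/

section Coordinates

open Finset

variable (p n : ℕ)

/-- The coordinates of the image of a class under `x_i ↦ ∑ t, y_i ^ p ^ t • x_t`. The action of the
general linear group becomes the action on these coordinates. -/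
def frobCoord (T : Finset (Fin n)) : Coh p n →ₗ[PolyPart p n] PolyPart p n :=
  (cohBasis p n).coord T ∘ₗ (substX p n (frobMatrix p n)).toLinearMap

theorem frobCoord_apply (T : Finset (Fin n)) (z : Coh p n) :
    frobCoord p n T z = (cohBasis p n).repr (substX p n (frobMatrix p n) z) T := rfl

theorem frobCoord_eq_sum (T : Finset (Fin n)) (z : Coh p n) :
    frobCoord p n T z = ∑ J, (cohBasis p n).repr z J * frobCoord p n T (cohBasis p n J) := by
  conv_lhs => rw [← (cohBasis p n).sum_repr z, map_sum]
  simp only [map_smul, smul_eq_mul]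

theorem frobCoord_cohBasis_of_card_ne {J T : Finset (Fin n)} (h : T.card ≠ J.card) :
    frobCoord p n T (cohBasis p n J) = 0 :=
  repr_substX_of_card_ne p n _ J T h

theorem frobCoord_empty_one : frobCoord p n ∅ 1 = 1 := by
  rw [frobCoord_apply, map_one, ← cohBasis_empty, Module.Basis.repr_self, Finsupp.single_eq_same]

theorem frobCoord_one_of_ne {T : Finset (Fin n)} (h : T ≠ ∅) : frobCoord p n T 1 = 0 := by
  rw [frobCoord_apply, map_one, ← cohBasis_empty, Module.Basis.repr_self,
    Finsupp.single_eq_of_ne h]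

theorem frobCoord_xCl (t i : Fin n) :
    frobCoord p n {t} (xCl p n i) = MvPolynomial.X i ^ p ^ (t : ℕ) := by
  rw [frobCoord_apply, substX_xCl, repr_xForm_singleton]
  rfl

/-- The row b of the Frobenius matrix is divisible by y_b, so the image of x_b, a factor of x_J up
to sign, is too. -/
theorem X_dvd_frobCoord_cohBasis [Fact p.Prime] {b : Fin n} {J : Finset (Fin n)} (hb : b ∈ J)
    (T : Finset (Fin n)) :
    (MvPolynomial.X b : PolyPart p n) ∣ frobCoord p n T (cohBasis p n J) := by
  let d : Fin n → PolyPart p n := Function.update (fun _ => 1) b (MvPolynomial.X b)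
  let Y : Matrix (Fin n) (Fin n) (PolyPart p n) :=
    (frobMatrix p n).updateRow b fun t => MvPolynomial.X b ^ (p ^ (t : ℕ) - 1)
  have h : Matrix.diagonal d * Y = frobMatrix p n := by
    ext1 i t
    rw [Matrix.diagonal_mul]
    by_cases hi : i = b
    · subst hi
      simp only [d, Y, Function.update_self, Matrix.updateRow_self, frobMatrix, Matrix.of_apply]
      rw [← pow_succ', Nat.sub_add_cancel (Nat.one_le_pow _ _ (Fact.out : p.Prime).pos)]
    · simp only [d, Y, Function.update_of_ne hi, Matrix.updateRow_ne hi, one_mul]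
  rw [frobCoord_apply, ← h, ← substX_substX, substX_diagonal, map_smul, map_smul, Finsupp.smul_apply,
    smul_eq_mul]
  refine Dvd.dvd.mul_right ?_ _
  have := dvd_prod_of_mem d hb
  rwa [show d b = MvPolynomial.X b from Function.update_self _ _ _] at this

variable [Fact p.Prime]

theorem frobCoord_actCoh (g : GL (Fin n) (ZMod p)) (T : Finset (Fin n)) (z : Coh p n) :
    frobCoord p n T (actCoh p n g z) = actPoly p n g (frobCoord p n T z) := by
  rw [frobCoord_apply, substX_frobMatrix_actCoh, repr_coeffAct]
  rfl

theorem frobCoord_ext {z z' : Coh p n} (h : ∀ T, frobCoord p n T z = frobCoord p n T z') : z = z' := by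
  refine substX_injective p n (frobMatrix p n) ?_ ((cohBasis p n).ext_elem h)
  rw [det_frobMatrix]
  exact lPoly_ne_zero p n

/-- In the twisted coordinates the group acts on each coordinate separately, and the coordinates
determine the class. -/
theorem mem_cohInvariants_iff_frobCoord (G : Subgroup (GL (Fin n) (ZMod p))) (z : Coh p n) :
    z ∈ cohInvariants p n G ↔ ∀ T, frobCoord p n T z ∈ polyInvariants p n G := by
  simp only [mem_cohInvariants, mem_polyInvariants, ← frobCoord_actCoh]
  exact ⟨fun h T g hg => by rw [h g hg], fun h g hg => frobCoord_ext p n fun T => h T g hg⟩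

/-- If b ∈ J, the coordinate of f supplies y_b^{p-2} and the image of x_J one more factor. Otherwise
the coordinate of f alone supplies y_b^{p-1}, which needs an index in J other than the first. -/
theorem X_pow_dvd_repr_mul_frobCoord {f : Coh p n} (hf : f ∈ cohInvariants p n (parabolic p n 1))
    {b : Fin n} {J : Finset (Fin n)} (h : b ∈ J ∨ ∃ a ∈ J, (a : ℕ) ≠ 0) (T : Finset (Fin n)) :
    (MvPolynomial.X b : PolyPart p n) ^ (p - 1) ∣
      (cohBasis p n).repr f J * frobCoord p n T (cohBasis p n J) := by
  by_cases hb : b ∈ J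
  · have hp := (Fact.out : p.Prime).two_le
    rw [show p - 1 = p - 2 + 1 by omega, pow_succ]
    exact mul_dvd_mul (X_pow_sub_two_dvd_repr p n hf hb) (X_dvd_frobCoord_cohBasis p n hb T)
  · obtain ⟨a, haJ, ha⟩ := h.resolve_left hb
    exact (X_pow_sub_one_dvd_repr p n hf ha haJ hb).mul_right _

theorem X_pow_dvd_frobCoord {f : Coh p n} (hf : f ∈ cohInvariants p n (parabolic p n 1))
    {b : Fin n} {T : Finset (Fin n)}
    (h : ∀ J : Finset (Fin n), T.card = J.card → b ∈ J ∨ ∃ a ∈ J, (a : ℕ) ≠ 0) :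
    (MvPolynomial.X b : PolyPart p n) ^ (p - 1) ∣ frobCoord p n T f := by
  rw [frobCoord_eq_sum]
  refine dvd_sum fun J _ => ?_
  by_cases hJ : T.card = J.card
  · exact X_pow_dvd_repr_mul_frobCoord p n hf (h J hJ) T
  · rw [frobCoord_cohBasis_of_card_ne p n hJ, mul_zero]
    exact dvd_zero _

theorem X_zero_pow_dvd_frobCoord {f : Coh p n} (hf : f ∈ cohInvariants p n (parabolic p n 1))
    (hn : 0 < n) {T : Finset (Fin n)} (hT : T.Nonempty) :
    (MvPolynomial.X ⟨0, hn⟩ : PolyPart p n) ^ (p - 1) ∣ frobCoord p n T f := by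
  refine X_pow_dvd_frobCoord p n hf fun J hJ => ?_
  obtain ⟨a, ha⟩ := card_pos.1 (hJ ▸ card_pos.2 hT)
  by_cases h0 : (a : ℕ) = 0
  · left
    rwa [show (⟨0, hn⟩ : Fin n) = a from Fin.ext h0.symm]
  · exact Or.inr ⟨a, ha, h0⟩

theorem X_pow_dvd_frobCoord_of_one_lt_card {f : Coh p n}
    (hf : f ∈ cohInvariants p n (parabolic p n 1)) (b : Fin n) {T : Finset (Fin n)}
    (hT : 1 < T.card) : (MvPolynomial.X b : PolyPart p n) ^ (p - 1) ∣ frobCoord p n T f := by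
  refine X_pow_dvd_frobCoord p n hf fun J hJ => Or.inr ?_
  obtain ⟨a, ha, a', ha', hne⟩ := one_lt_card.1 (hJ ▸ hT)
  by_cases h0 : (a : ℕ) = 0
  · exact ⟨a', ha', fun h => hne (Fin.ext (h0.trans h.symm))⟩
  · exact ⟨a, ha, h0⟩

/-- In exterior degree one only the x_1 term can fail to be divisible by y_b^{p-1}. Subtracting
y_1^{p^t-1} times the vanishing coordinate removes exactly that term, since y_1^{p^t} = y_1^{p^t-1}
y_1. -/
theorem X_pow_dvd_frobCoord_singleton {f : Coh p n} (hf : f ∈ cohInvariants p n (parabolic p n 1))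
    (hn : 0 < n) (h0 : frobCoord p n {⟨0, hn⟩} f = 0) (b t : Fin n) :
    (MvPolynomial.X b : PolyPart p n) ^ (p - 1) ∣ frobCoord p n {t} f := by
  have hp := (Fact.out : p.Prime).two_le
  have h1 : frobCoord p n {t} f = ∑ J, (cohBasis p n).repr f J *
      (frobCoord p n {t} (cohBasis p n J) - MvPolynomial.X ⟨0, hn⟩ ^ (p ^ (t : ℕ) - 1) *
        frobCoord p n {⟨0, hn⟩} (cohBasis p n J)) := by
    have h2 : frobCoord p n {t} f = frobCoord p n {t} f -
        MvPolynomial.X ⟨0, hn⟩ ^ (p ^ (t : ℕ) - 1) * frobCoord p n {⟨0, hn⟩} f := by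
      rw [h0, mul_zero, sub_zero]
    rw [h2, frobCoord_eq_sum, frobCoord_eq_sum p n {⟨0, hn⟩}, mul_sum, ← sum_sub_distrib]
    exact sum_congr rfl fun J _ => by ring
  have hpos : 1 ≤ p ^ (t : ℕ) := Nat.one_le_pow _ _ (by omega)
  rw [h1]
  refine dvd_sum fun J _ => ?_
  by_cases hJ : J.card = 1
  · obtain ⟨j, rfl⟩ := card_eq_one.1 hJ
    rw [cohBasis_singleton, frobCoord_xCl, frobCoord_xCl, pow_zero, pow_one]
    by_cases hj : (j : ℕ) = 0
    · rw [show (⟨0, hn⟩ : Fin n) = j from Fin.ext hj.symm, ← pow_succ, Nat.sub_add_cancel hpos,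
        sub_self, mul_zero]
      exact dvd_zero _
    · by_cases hb : b = j
      · subst hb
        rw [show p - 1 = p - 2 + 1 by omega, pow_succ]
        refine mul_dvd_mul (X_pow_sub_two_dvd_repr p n hf (mem_singleton_self b)) ?_
        exact dvd_sub (dvd_pow_self _ (by omega)) (Dvd.intro_left _ rfl)
      · exact (X_pow_sub_one_dvd_repr p n hf hj (mem_singleton_self j)
          (by simpa using hb)).mul_right _
  · rw [frobCoord_cohBasis_of_card_ne, frobCoord_cohBasis_of_card_ne]
    · simp
    · simpa using Ne.symm hJ
    · simpa using Ne.symm hJ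

theorem lPoly_pow_dvd_frobCoord {f : Coh p n} (hf : f ∈ cohInvariants p n (parabolic p n 1))
    (hn : 0 < n) (h0 : frobCoord p n {⟨0, hn⟩} f = 0) {T : Finset (Fin n)} (hT : T.Nonempty) :
    lPoly p n ^ (p - 1) ∣ frobCoord p n T f := by
  refine lPoly_pow_dvd p n ((mem_cohInvariants_iff_frobCoord p n _ f).1 hf T) fun b => ?_
  by_cases h : T.card = 1
  · obtain ⟨t, rfl⟩ := card_eq_one.1 h
    exact X_pow_dvd_frobCoord_singleton p n hf hn h0 b t
  · exact X_pow_dvd_frobCoord_of_one_lt_card p n hf b (by have := card_pos.2 hT; omega)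

theorem mem_polyInvariants_of_mul {G : Subgroup (GL (Fin n) (ZMod p))} {a q : PolyPart p n}
    (ha : a ∈ polyInvariants p n G) (ha0 : a ≠ 0) (h : a * q ∈ polyInvariants p n G) :
    q ∈ polyInvariants p n G := by
  rw [mem_polyInvariants] at ha h ⊢
  intro g hg
  have := h g hg
  rw [map_mul, ha g hg] at this
  exact mul_left_cancel₀ ha0 this

theorem lPoly_pow_mem (G : Subgroup (GL (Fin n) (ZMod p))) :
    lPoly p n ^ (p - 1) ∈ polyInvariants p n G :=
  (mem_polyInvariants p n G _).2 fun g _ => actPoly_lPoly_pow p n g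

/-- An element of the parabolic scales y_1 by some unit a, and a^{p-2+p^t} = a^{p-1} = 1. These
powers are the twisted coordinates of M_{1,0} h_1^{p-2}. -/
theorem X_zero_pow_mem (hn : 0 < n) (t : ℕ) :
    (MvPolynomial.X ⟨0, hn⟩ : PolyPart p n) ^ (p - 2 + p ^ t) ∈
      polyInvariants p n (parabolic p n 1) := by
  rw [mem_polyInvariants]
  intro g hg
  obtain ⟨a, -, ha⟩ := actPoly_X_zero p n hg hn
  have hp := (Fact.out : p.Prime).two_le
  rw [map_pow, ha, mul_pow, ← map_pow, pow_add, ZMod.pow_card_pow, ← pow_succ,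
    show p - 2 + 1 = p - 1 by omega, ZMod.pow_card_sub_one_eq_one a.ne_zero, map_one, one_mul]

end Coordinates

/-! ### The invariants as a module -/

section ModuleStructure

open Finset

variable (p n : ℕ)

theorem mul_tmul_one (z : Coh p n) (s : PolyPart p n) :
    z * (s ⊗ₜ[ZMod p] (1 : ExtPart p n)) = s • z :=
  (Algebra.commutes s z).symm.trans (Algebra.smul_def s z).symm

theorem muiM_one_zero (hn : 1 ≤ n) : muiM p n 1 hn {0} = xCl p n ⟨0, hn⟩ := by
  rw [muiM, muiDet, sum_eq_single 1]
  · simp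
    rfl
  · intro σ _ hσ
    exact absurd (Subsingleton.elim _ _) hσ
  · intro h
    refine absurd ?_ h
    simp

variable [Fact p.Prime] (hn : 2 ≤ n)

theorem cohGen_inr_inl (u : Unit) : cohGen p n hn (.inr (.inl u)) =
    (MvPolynomial.X ⟨0, by omega⟩ : PolyPart p n) ^ (p - 2) • xCl p n ⟨0, by omega⟩ := by
  rw [cohGen, mul_tmul_one, muiM_one_zero, hPoly_zero]

/-- The subset of `Fin n` that corresponds to an index set. -/
def TopIndex.toFinset {n : ℕ} (T : TopIndex n) : Finset (Fin n) := {i | (i : ℕ) ∈ T.val}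

theorem TopIndex.map_toFinset {n : ℕ} (T : TopIndex n) :
    T.toFinset.map Fin.valEmbedding = T.val := by
  ext t
  simp only [TopIndex.toFinset, mem_map, mem_filter, mem_univ, true_and, Fin.valEmbedding_apply]
  refine ⟨?_, fun h => ⟨⟨t, T.2.1 t h⟩, h, rfl⟩⟩
  rintro ⟨i, hi, rfl⟩
  exact hi

theorem TopIndex.toFinset_injective {n : ℕ} :
    Function.Injective (TopIndex.toFinset : TopIndex n → Finset (Fin n)) := fun T T' h => by
  rw [Subtype.ext_iff, ← T.map_toFinset, h, T'.map_toFinset]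

theorem TopIndex.exists_mem_toFinset {n : ℕ} (T : TopIndex n) : ∃ i ∈ T.toFinset, 1 ≤ (i : ℕ) := by
  obtain ⟨t, ht, h1⟩ := T.2.2
  exact ⟨⟨t, T.2.1 t ht⟩, by simpa [TopIndex.toFinset] using ht, h1⟩

theorem TopIndex.exists_toFinset_eq {n : ℕ} {J : Finset (Fin n)} (h : ∃ i ∈ J, 1 ≤ (i : ℕ)) :
    ∃ T : TopIndex n, T.toFinset = J := by
  obtain ⟨i, hi, h1⟩ := h
  refine ⟨⟨J.map Fin.valEmbedding, ?_, i, mem_map_of_mem Fin.valEmbedding hi, h1⟩, ?_⟩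
  · intro t ht
    obtain ⟨j, -, rfl⟩ := mem_map.1 ht
    exact j.2
  · ext j
    simp only [TopIndex.toFinset, mem_filter, mem_univ, true_and]
    exact mem_map' Fin.valEmbedding

theorem frobCoord_cohGen_inr_inr (T : TopIndex n) :
    ∃ ε : ℤˣ, ∀ J, frobCoord p n J (cohGen p n hn (.inr (.inr T))) =
      if J = T.toFinset then (ε : ℤ) • lPoly p n ^ (p - 1) else 0 := by
  obtain ⟨ε, hε⟩ := substX_muiM p n T.toFinset
  refine ⟨ε, fun J => ?_⟩
  have hp := (Fact.out : p.Prime).two_le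
  rw [cohGen, mul_tmul_one, map_smul, frobCoord_apply, ← T.map_toFinset, hε, map_zsmul, map_smul,
    Module.Basis.repr_self, Finsupp.smul_apply, Finsupp.smul_apply, Finsupp.single_apply]
  simp only [eq_comm (a := J)]
  split_ifs
  · rw [smul_eq_mul, smul_eq_mul, mul_one, mul_smul_comm, ← pow_succ, show p - 2 + 1 = p - 1 by omega]
  · simp

theorem frobCoord_cohGen_inr_inl (u : Unit) (t : Fin n) :
    frobCoord p n {t} (cohGen p n hn (.inr (.inl u))) =
      MvPolynomial.X ⟨0, by omega⟩ ^ (p - 2 + p ^ (t : ℕ)) := by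
  rw [cohGen_inr_inl, map_smul, frobCoord_xCl, smul_eq_mul, pow_add]

theorem frobCoord_cohGen_inr_inl_of_card_ne (u : Unit) {J : Finset (Fin n)} (hJ : J.card ≠ 1) :
    frobCoord p n J (cohGen p n hn (.inr (.inl u))) = 0 := by
  rw [cohGen_inr_inl, map_smul, ← cohBasis_singleton, frobCoord_cohBasis_of_card_ne _ _ (by simpa),
    smul_zero]

theorem cohGen_mem (i : Unit ⊕ Unit ⊕ TopIndex n) :
    cohGen p n hn i ∈ cohInvariants p n (parabolic p n 1) := by
  rw [mem_cohInvariants_iff_frobCoord]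
  intro J
  match i with
  | .inl _ => exact (mem_cohInvariants_iff_frobCoord p n _ 1).1 (one_mem _) J
  | .inr (.inl u) =>
    by_cases hJ : J.card = 1
    · obtain ⟨t, rfl⟩ := card_eq_one.1 hJ
      rw [frobCoord_cohGen_inr_inl]
      exact X_zero_pow_mem p n _ _
    · rw [frobCoord_cohGen_inr_inl_of_card_ne p n hn u hJ]
      exact zero_mem _
  | .inr (.inr T) =>
    obtain ⟨ε, hε⟩ := frobCoord_cohGen_inr_inr p n hn T
    rw [hε]
    split_ifs
    · exact zsmul_mem (lPoly_pow_mem p n _) _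
    · exact zero_mem _

theorem smul_mem_cohInvariants {G : Subgroup (GL (Fin n) (ZMod p))} {s : PolyPart p n} {z : Coh p n}
    (hs : s ∈ polyInvariants p n G) (hz : z ∈ cohInvariants p n G) : s • z ∈ cohInvariants p n G := by
  rw [mem_cohInvariants_iff_frobCoord] at hz ⊢
  intro T
  rw [map_smul]
  exact mul_mem hs (hz T)

theorem exists_one_le_of_ne {J : Finset (Fin n)} (h : J ≠ ∅) (h' : J ≠ {⟨0, by omega⟩}) :
    ∃ i ∈ J, 1 ≤ (i : ℕ) := by
  by_contra! h2
  refine h' (eq_singleton_iff_nonempty_unique_mem.2 ⟨nonempty_iff_ne_empty.2 h, fun i hi => ?_⟩)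
  exact Fin.ext (Nat.lt_one_iff.1 (h2 i hi))

/-- Each coordinate of f can be realized alone by a multiple of one generator: 1 at the empty set,
nothing at the first singleton where f vanishes, and M_{n,T} L_n^{p-2} elsewhere, after dividing the
coordinate by L_n^{p-1}. -/
theorem exists_mem_span_cohGen {f : Coh p n} (hf : f ∈ cohInvariants p n (parabolic p n 1))
    (h0 : frobCoord p n {⟨0, by omega⟩} f = 0) (J : Finset (Fin n)) :
    ∃ z ∈ Submodule.span (polyInvariants p n (parabolic p n 1)) (Set.range (cohGen p n hn)),
      ∀ T, frobCoord p n T z = if T = J then frobCoord p n J f else 0 := by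
  have hspan : ∀ i (s : PolyPart p n), s ∈ polyInvariants p n (parabolic p n 1) →
      s • cohGen p n hn i ∈
        Submodule.span (polyInvariants p n (parabolic p n 1)) (Set.range (cohGen p n hn)) :=
    fun i s hs => Submodule.smul_mem _ (⟨s, hs⟩ : polyInvariants p n (parabolic p n 1))
      (Submodule.subset_span ⟨i, rfl⟩)
  have hfJ := (mem_cohInvariants_iff_frobCoord p n _ f).1 hf J
  by_cases hJ : J = ∅
  · refine ⟨_, hspan (.inl ()) _ hfJ, fun T => ?_⟩
    rw [map_smul, cohGen]
    split_ifs with h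
    · rw [h, hJ, frobCoord_empty_one, smul_eq_mul, mul_one]
    · rw [frobCoord_one_of_ne p n (hJ ▸ h), smul_zero]
  by_cases hJ' : J = {⟨0, by omega⟩}
  · refine ⟨0, zero_mem _, fun T => ?_⟩
    rw [hJ', h0, map_zero, ite_self]
  obtain ⟨T, rfl⟩ := TopIndex.exists_toFinset_eq (exists_one_le_of_ne n hn hJ hJ')
  obtain ⟨q, hq⟩ := lPoly_pow_dvd_frobCoord p n hf (by omega) h0 (nonempty_iff_ne_empty.2 hJ)
  obtain ⟨ε, hε⟩ := frobCoord_cohGen_inr_inr p n hn T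
  have hqm : q ∈ polyInvariants p n (parabolic p n 1) :=
    mem_polyInvariants_of_mul p n (lPoly_pow_mem p n _) (pow_ne_zero _ (lPoly_ne_zero p n)) (hq ▸ hfJ)
  refine ⟨_, zsmul_mem (hspan (.inr (.inr T)) q hqm) ε, fun U => ?_⟩
  rw [map_zsmul, map_smul, hε]
  split_ifs
  · rw [smul_comm, smul_smul, ← Units.val_mul, Int.units_mul_self, Units.val_one, one_smul, hq,
      smul_eq_mul, mul_comm]
  · simp

theorem span_cohGen_eq :
    (Submodule.span (polyInvariants p n (parabolic p n 1)) (Set.range (cohGen p n hn)) :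
      Set (Coh p n)) = cohInvariants p n (parabolic p n 1) := by
  have hp := (Fact.out : p.Prime).two_le
  refine Set.Subset.antisymm (fun z hz => ?_) fun f hf => ?_
  · refine Submodule.span_induction (p := fun z _ => z ∈ cohInvariants p n (parabolic p n 1))
      ?_ (zero_mem _) (fun _ _ _ _ => add_mem) (fun s z _ hz => ?_) hz
    · rintro _ ⟨i, rfl⟩
      exact cohGen_mem p n hn i
    · exact smul_mem_cohInvariants p n s.2 hz
  · have hf : f ∈ cohInvariants p n (parabolic p n 1) := hf
    -- At the first singleton M_{1,0} h_1^{p-2} has coordinate y_1^{p-1}, so q is the coefficient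
    -- whose multiple cancels this coordinate of f.
    obtain ⟨q, hq⟩ := X_zero_pow_dvd_frobCoord p n hf (by omega) (singleton_nonempty ⟨0, by omega⟩)
    have hX : p - 2 + p ^ 0 = p - 1 := by rw [pow_zero]; omega
    have hqm : q ∈ polyInvariants p n (parabolic p n 1) := by
      refine mem_polyInvariants_of_mul p n (hX ▸ X_zero_pow_mem p n (by omega) 0)
        (pow_ne_zero _ (MvPolynomial.X_ne_zero _)) ?_
      rw [← hq]
      exact (mem_cohInvariants_iff_frobCoord p n _ f).1 hf _
    have hz := smul_mem_cohInvariants p n hqm (cohGen_mem p n hn (.inr (.inl ())))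
    have hf1 := sub_mem hf hz
    have h0 : frobCoord p n {⟨0, by omega⟩} (f - q • cohGen p n hn (.inr (.inl ()))) = 0 := by
      rw [map_sub, map_smul, frobCoord_cohGen_inr_inl, hq, smul_eq_mul, hX, mul_comm, sub_self]
    choose z hzs hz using exists_mem_span_cohGen p n hn hf1 h0
    have h1 : f - q • cohGen p n hn (.inr (.inl ())) = ∑ J, z J := by
      refine frobCoord_ext p n fun T => ?_
      rw [map_sum]
      simp only [hz, sum_ite_eq, mem_univ, if_true]
    rw [sub_eq_iff_eq_add.1 h1]
    refine add_mem (sum_mem fun J _ => hzs J) ?_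
    exact Submodule.smul_mem _ (⟨q, hqm⟩ : polyInvariants p n (parabolic p n 1))
      (Submodule.subset_span ⟨_, rfl⟩)

/-- The coordinates at the empty set and the first singleton isolate the first two generators. The
second has nonzero coordinates at every singleton, so its coefficient must be shown to vanish before
those at the sets T are read off. -/
theorem linearIndependent_cohGen : LinearIndependent (PolyPart p n) (cohGen p n hn) := by
  rw [linearIndependent_iff]
  intro l hl
  have hc : ∀ J, l.sum (fun i s => s * frobCoord p n J (cohGen p n hn i)) = 0 := by
    intro J
    have := congrArg (frobCoord p n J) hl
    rw [Finsupp.linearCombination_apply, map_finsuppSum, map_zero] at this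
    simpa only [map_smul, smul_eq_mul] using this
  have key : ∀ i J, frobCoord p n J (cohGen p n hn i) ≠ 0 →
      (∀ j ≠ i, l j ≠ 0 → frobCoord p n J (cohGen p n hn j) = 0) → l i = 0 := by
    intro i J hi hj
    have := hc J
    rw [Finsupp.sum_eq_single i (fun j hlj hji => by rw [hj j hji hlj, mul_zero]) (by simp)] at this
    exact (mul_eq_zero.1 this).resolve_right hi
  have hT : ∀ (T : TopIndex n) (J : Finset (Fin n)), J ≠ T.toFinset →
      frobCoord p n J (cohGen p n hn (.inr (.inr T))) = 0 := by
    intro T J h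
    obtain ⟨ε, hε⟩ := frobCoord_cohGen_inr_inr p n hn T
    rw [hε, if_neg h]
  have h0 : ∀ T : TopIndex n, T.toFinset ≠ ∅ := by
    intro T h
    obtain ⟨i, hi, -⟩ := T.exists_mem_toFinset
    rw [h] at hi
    exact notMem_empty i hi
  have h1 : ∀ T : TopIndex n, T.toFinset ≠ {⟨0, by omega⟩} := by
    intro T h
    obtain ⟨i, hi, hi1⟩ := T.exists_mem_toFinset
    rw [h, mem_singleton] at hi
    rw [hi] at hi1
    exact absurd hi1 (by simp)
  have e1 : l (.inl ()) = 0 := by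
    refine key _ ∅ ?_ ?_
    · rw [cohGen, frobCoord_empty_one]
      exact one_ne_zero
    · rintro (_ | u | T) hne -
      · exact absurd rfl hne
      · exact frobCoord_cohGen_inr_inl_of_card_ne p n hn u (by simp)
      · exact hT T _ (h0 T).symm
  have e2 : l (.inr (.inl ())) = 0 := by
    refine key _ {⟨0, by omega⟩} ?_ ?_
    · rw [frobCoord_cohGen_inr_inl]
      exact pow_ne_zero _ (MvPolynomial.X_ne_zero _)
    · rintro (_ | _ | T) hne hl
      · exact absurd e1 hl
      · exact absurd rfl hne
      · exact hT T _ (h1 T).symm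
  ext1 i
  rw [Finsupp.zero_apply]
  match i with
  | .inl () => exact e1
  | .inr (.inl ()) => exact e2
  | .inr (.inr T) =>
    refine key _ T.toFinset ?_ ?_
    · obtain ⟨ε, hε⟩ := frobCoord_cohGen_inr_inr p n hn T
      rw [hε, if_pos rfl]
      rcases Int.isUnit_iff.1 ε.isUnit with h | h <;>
        simp [h, lPoly_ne_zero p n]
    · rintro (_ | _ | T') hne hl
      · exact absurd e1 hl
      · exact absurd e2 hl
      · exact hT T' _ fun h => hne (by rw [TopIndex.toFinset_injective h])

theorem linearIndependent_polyInvariants_cohGen (G : Subgroup (GL (Fin n) (ZMod p))) :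
    LinearIndependent (polyInvariants p n G) (cohGen p n hn) := by
  refine (linearIndependent_cohGen p n hn).restrict_scalars fun s s' h => Subtype.ext ?_
  simpa [Algebra.smul_def] using h

end ModuleStructure

end ParabolicInvariants

end

/-! ### The three statements assembled -/

theorem theoremd (p n : ℕ) [Fact p.Prime] (hp : p ≠ 2) (hn : 2 ≤ n) :
    (AlgebraicIndependent (ZMod p) (ParabolicInvariants.polyGen p n) ∧
      Algebra.adjoin (ZMod p) (Set.range (ParabolicInvariants.polyGen p n)) =
        ParabolicInvariants.polyInvariants p n (ParabolicInvariants.parabolic p n 1)) ∧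
    ParabolicInvariants.SteenrodClosed p n
      ((Algebra.adjoin (ZMod p) (Set.range (ParabolicInvariants.polyGen p n))).map
        Algebra.TensorProduct.includeLeft) ∧
    (LinearIndependent
        (ParabolicInvariants.polyInvariants p n (ParabolicInvariants.parabolic p n 1))
        (ParabolicInvariants.cohGen p n hn) ∧
      (Submodule.span
          (ParabolicInvariants.polyInvariants p n (ParabolicInvariants.parabolic p n 1))
          (Set.range (ParabolicInvariants.cohGen p n hn)) : Set (ParabolicInvariants.Coh p n)) =
        ParabolicInvariants.cohInvariants p n (ParabolicInvariants.parabolic p n 1)) := by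
  have h := ParabolicInvariants.adjoin_polyGen_eq p n (by omega)
  rw [ParabolicInvariants.polyGenAlg] at h
  refine ⟨⟨ParabolicInvariants.algebraicIndependent_polyGen p n (by omega), h⟩, ?_,
    ParabolicInvariants.linearIndependent_polyInvariants_cohGen p n hn _,
    ParabolicInvariants.span_cohGen_eq p n hn⟩
  -- Closure under the reduced powers is checked on the ring of invariants, which equals the
  -- generated algebra.
  refine ParabolicInvariants.steenrodClosed_map_includeLeft p n _ fun m f hf => ?_
  rw [h] at hf ⊢
  exact ParabolicInvariants.powerPoly_mem p n m f _ hf
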